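/- **Setting.** Let $K\ge 2$ users and $N\ge 2$ samples of channels $h^{(r)}=(h^{(r)}_{kj})\in\mathbb C^{K\times K}$, $r=1,\dots,N$, be given, with weights $w_k\ge 0$, noise levels $\sigma_k>0$ and power budget $P_{\max}>0$. For $p\in\mathbb R^K$ put $$I_k^{(r)}(p)=\sum_{j\ne k}|h^{(r)}_{kj}|^2p_j+\sigma_k^2,\qquad R_r(p)=\sum_{k=1}^K w_k\log\Bigl(1+\frac{|h^{(r)}_{kk}|^2p_k}{I^{(r)}_k(p)}\Bigr).$$ Let $\bar p^{(r)}\in\mathbb R^K$ be labels such that each $\bar p^{(r)}$ is a KKT point of $\max\{R_r(p):0\le p_k\le P_{\max}\ \forall k\}$. Let $\mathbf H\in\mathbb R^{N\times K^2}$ be the matrix whose $r$-th row lists the numbers $|h^{(r)}_{kj}|$ (in an order that is the same for all $r$). *Network.* Let $L\ge 2$ and let $n_0=K^2,n_1,\dots,n_L=K$ satisfy $n_1\ge N$ and $n_1\ge n_2\ge\dots\ge n_L$. For $\Theta=(W_1,\dots,W_L)$, $W_l\in\mathbb R^{n_{l-1}\times n_l}$ (with the Euclidean norm on the space of all $\Theta$),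 put $F_0=\mathbf H$, $F_l=a(F_{l-1}W_l)$ for $1\le l\le L-1$ and $F_L=b(F_{L-1}W_L)\in\mathbb R^{N\times K}$, componentwise; let $q^{(r)}(\Theta)$ be the $r$-th row of $F_L$. Here $a:\mathbb R\to\mathbb R$ is differentiable with $a'(x)\in[\gamma,1]$, $|a(x)|\le|x|$ and $a'$ $\beta$-Lipschitz, for some $\gamma\in(0,1)$, $\beta>0$; and, for a parameter $\alpha>0$, $b$ is the SCReLU function: $b(x)=\alpha(e^{x/\alpha}-1)$ for $x<0$, $b(x)=x$ for $0\le x\le P_{\max}$, $b(x)=P_{\max}+\alpha(1-e^{(P_{\max}-x)/\alpha})$ for $x>P_{\max}$. *Losses.* $f_{\rm SL}(\Theta)=\frac12\sum_{r}\|q^{(r)}(\Theta)-\bar p^{(r)}\|^2$ and $f_{\rm UL}(\Theta)=-\sum_{r}R_r(q^{(r)}(\Theta))$. Gradient descent on $f$ with step size $\eta>0$ from $\Theta^0$ is $\Theta^{m+1}=\Theta^m-\eta\nabla f(\Theta^m)$, $m\ge 0$. *Initialization.* Let $\Theta^0=(W^0_l)_l$. Write $\sigma_{\max}(A)$ for the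 largest and $\sigma_{\min}(A)$ for the smallest (i.e. $\min(p,q)$-th largest) singular value of a $p\times q$ matrix $A$. Put $\underline\lambda_l=\sigma_{\min}(W_l^0)$, $\bar\lambda_l=\frac23(1+\sigma_{\max}(W_l^0))$ for $l\in\{1,2\}$, $\bar\lambda_l=\sigma_{\max}(W_l^0)$ for $l\ge3$, $\underline\lambda_{3\to L}=\prod_{l=3}^L\underline\lambda_l$, $\bar\lambda_{3\to L}=\prod_{l=3}^L\bar\lambda_l$ (empty products are $1$), $\underline\lambda_H=\sigma_{\min}(a(\mathbf HW_1^0))$, $\underline\alpha_H=(\tfrac32)^L\|\mathbf H\|_F\prod_{l=1}^L\bar\lambda_l$, and $$\Lambda_1=\Bigl(\tfrac{\gamma^4}{3}\bigl(\tfrac{6}{\gamma^2}\bigr)^L\|\mathbf H\|_F\sqrt{2f_{\rm SL}(\Theta^0)}\,\tfrac{\bar\lambda_{3\to L}}{\underline\lambda_{3\to L}^2}\,e^{2\underline\alpha_H/\alpha}\max\Bigl(\tfrac{2\bar\lambda_1\bar\lambda_2}{\min_{3\le l\le L}\underline\lambda_l\bar\lambda_l},\bar\lambda_1,\bar\lambda_2\Bigr)\Bigr)^{1/2},$$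 $$\Lambda_2=\Bigl(\tfrac{2\gamma^4}{3}\bigl(\tfrac{6}{\gamma^2}\bigr)^L\sigma_{\max}(\mathbf H)\|\mathbf H\|_F\,e^{2\underline\alpha_H/\alpha}\sqrt{2f_{\rm SL}(\Theta^0)}\,\tfrac{\bar\lambda_{3\to L}}{\underline\lambda_{3\to L}^2}\,\bar\lambda_2\Bigr)^{1/3},$$ where for $L=2$ the first entry of the maximum is omitted. Assume $\underline\lambda_l>0$ for $3\le l\le L$, $\underline\lambda_H>0$ and $\underline\lambda_H\ge\max(\Lambda_1,\Lambda_2)$. Finally let $$\alpha_0=e^{-2}\gamma^{2(L-2)}\bigl(\tfrac12\bigr)^{2(L-1)}\underline\lambda_{3\to L}^2\,\underline\lambda_H^2 .$$ **Theorem.** 1. (Supervised training.) If $\alpha\ge\underline\alpha_H$, then $\alpha_0>0$ and there is $\bar\eta>0$ such that for every $\eta\in(0,\bar\eta)$ we have $\eta\alpha_0<1$, the gradient descent iterates $\Theta^m$ on $f_{\rm SL}$ from $\Theta^0$ converge to some $\Theta^*$ with $f_{\rm SL}(\Theta^*)=0$, and $f_{\rm SL}(\Theta^m)\le(1-\eta\alpha_0)^m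 f_{\rm SL}(\Theta^0)$ for all $m\ge0$. 2. (Unsupervised training.) For all $B\in\mathbb R$ and $\delta>0$ there is $\bar\eta>0$ such that for every $\eta\in(0,\bar\eta)$ the following holds for the gradient descent iterates $\Theta^m$ on $f_{\rm UL}$ from $\Theta^0$: if $\|\Theta^m\|\le B$ for all $m$, and the rates stay uniformly well defined along the iterates, that is, $I_k^{(r)}(q^{(r)}(\Theta^m))\ge\delta$ and $I_k^{(r)}(q^{(r)}(\Theta^m))+|h_{kk}^{(r)}|^2q^{(r)}_k(\Theta^m)\ge\delta$ for all $m,r,k$, then $\lim_{m\to\infty}\nabla f_{\rm UL}(\Theta^m)=0$. -/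

import Mathlib

namespace WSR

noncomputable section

/-! ### Singular values of real matrices -/

/-- The largest singular value of a real matrix. -/
def sigmaMax {p q : ℕ} (A : Matrix (Fin p) (Fin q) ℝ) : ℝ :=
  (Matrix.toEuclideanLin A).singularValues 0

/-- The smallest singular value of a real `p × q` matrix, that is, the `min p q`-th largest one
(singular values are numbered from `0` in decreasing order). -/
def sigmaMin {p q : ℕ} (A : Matrix (Fin p) (Fin q) ℝ) : ℝ :=
  (Matrix.toEuclideanLin A).singularValues (min p q - 1)

/-- The Frobenius norm of a real matrix. -/
def frobNorm {p q : ℕ} (A : Matrix (Fin p) (Fin q) ℝ) : ℝ :=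
  Real.sqrt (∑ i, ∑ j, A i j ^ 2)

/-! ### The weighted sum-rate problem -/

/-- Received interference plus noise at receiver `k`, for channel magnitudes `g`, noise standard
deviations `σ` and powers `p`. -/
def interference {K : ℕ} (σ : Fin K → ℝ) (g : Fin K → Fin K → ℝ) (p : Fin K → ℝ) (k : Fin K) : ℝ :=
  (∑ j ∈ Finset.univ.erase k, g k j ^ 2 * p j) + σ k ^ 2

/-- The weighted sum-rate `R(p; g)`. -/
def sumRate {K : ℕ} (w σ : Fin K → ℝ) (g : Fin K → Fin K → ℝ) (p : Fin K → ℝ) : ℝ :=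
  ∑ k, w k * Real.log (1 + g k k ^ 2 * p k / interference σ g p k)

/-- `p` is a stationary point (KKT point) of the problem of maximizing `R(·; g)` over
`0 ≤ p k ≤ Pmax`; `lam` and `mu` are the multipliers. -/
def IsKKT {K : ℕ} (w σ : Fin K → ℝ) (Pmax : ℝ) (g : Fin K → Fin K → ℝ) (p : Fin K → ℝ) : Prop :=
  ∃ lam mu : Fin K → ℝ, ∀ k,
    -deriv (fun t : ℝ => sumRate w σ g (Function.update p k t)) (p k) - lam k + mu k = 0 ∧
    0 ≤ p k ∧ p k ≤ Pmax ∧ 0 ≤ lam k ∧ 0 ≤ mu k ∧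
    lam k * p k = 0 ∧ mu k * (p k - Pmax) = 0

/-! ### The network -/

/-- The smoothed clipped ReLU. -/
def screlu (α Pmax x : ℝ) : ℝ :=
  if x < 0 then α * (Real.exp (1 / α * x) - 1)
  else if x ≤ Pmax then x
  else Pmax + α * (1 - Real.exp ((Pmax - x) / α))

/-- The conditions on the hidden activation. -/
structure IsActivation (γ β : ℝ) (a : ℝ → ℝ) : Prop where
  gamma_mem : γ ∈ Set.Ioo (0 : ℝ) 1
  beta_pos : 0 < β
  differentiable : Differentiable ℝ a
  deriv_mem : ∀ x, deriv a x ∈ Set.Icc γ 1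
  abs_le : ∀ x, |a x| ≤ |x|
  deriv_lipschitz : ∀ x y, |deriv a x - deriv a y| ≤ β * |x - y|

/-- All the weights of an `L`-layer network with widths `n 0, …, n L`, as one Euclidean vector. -/
abbrev Params (L : ℕ) (n : ℕ → ℕ) : Type :=
  EuclideanSpace ℝ (Σ l : Fin L, Fin (n l) × Fin (n (l + 1)))

/-- `weight Θ l` is the weight matrix from layer `l` to layer `l + 1`, i.e. `W_{l+1}`, for `l < L`
(there is no weight for `l ≥ L`, and the value there is irrelevant). -/
def weight {L : ℕ} {n : ℕ → ℕ} (Θ : Params L n) (l : ℕ) :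
    Matrix (Fin (n l)) (Fin (n (l + 1))) ℝ :=
  if hl : l < L then Matrix.of fun i j => Θ ⟨⟨l, hl⟩, (i, j)⟩ else 0

/-- The layer outputs `F_l` over all samples: hidden activation `a`, output activation `b`. -/
def layer {L N : ℕ} {n : ℕ → ℕ} (a b : ℝ → ℝ) (H : Matrix (Fin N) (Fin (n 0)) ℝ)
    (Θ : Params L n) : (l : ℕ) → Matrix (Fin N) (Fin (n l)) ℝ
  | 0 => H
  | l + 1 => (layer a b H Θ l * weight Θ l).map (if l + 1 = L then b else a)

/-- The channel magnitudes of sample `r`. -/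
def absChannel {N K : ℕ} (h : Fin N → Fin K → Fin K → ℂ) (r : Fin N) : Fin K → Fin K → ℝ :=
  fun k j => ‖h r k j‖

/-- The input matrix: row `r` stacks the `K²` channel magnitudes of sample `r`, in the order `e`. -/
def inputMatrix {N K d : ℕ} (e : Fin d ≃ Fin K × Fin K) (h : Fin N → Fin K → Fin K → ℂ) :
    Matrix (Fin N) (Fin d) ℝ :=
  Matrix.of fun r i => absChannel h r (e i).1 (e i).2

/-- The network outputs `q`, one row per sample, with SCReLU at the output layer. -/
def output {L N : ℕ} {n : ℕ → ℕ} (a : ℝ → ℝ) (α Pmax : ℝ)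
    (H : Matrix (Fin N) (Fin (n 0)) ℝ) (Θ : Params L n) : Fin N → Fin (n L) → ℝ :=
  fun r k => layer a (screlu α Pmax) H Θ L r k

/-! ### The two losses and gradient descent -/

/-- The supervised loss, with labels `pbar`. -/
def lossSL {L N : ℕ} {n : ℕ → ℕ} (a : ℝ → ℝ) (α Pmax : ℝ) (H : Matrix (Fin N) (Fin (n 0)) ℝ)
    (pbar : Fin N → Fin (n L) → ℝ) (Θ : Params L n) : ℝ :=
  1 / 2 * ∑ r, ∑ k, (output a α Pmax H Θ r k - pbar r k) ^ 2

/-- The unsupervised loss: minus the total weighted sum-rate, for channel magnitudes `g`. -/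
def lossUL {L N : ℕ} {n : ℕ → ℕ} (a : ℝ → ℝ) (α Pmax : ℝ) (H : Matrix (Fin N) (Fin (n 0)) ℝ)
    (w σ : Fin (n L) → ℝ) (g : Fin N → Fin (n L) → Fin (n L) → ℝ) (Θ : Params L n) : ℝ :=
  ∑ r, -sumRate w σ (g r) (output a α Pmax H Θ r)

/-- The `m`-th iterate of gradient descent on `f` with step size `η`, started at `Θ₀`. -/
def gd {L : ℕ} {n : ℕ → ℕ} (f : Params L n → ℝ) (η : ℝ) (Θ₀ : Params L n) : ℕ → Params L n
  | 0 => Θ₀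
  | m + 1 => gd f η Θ₀ m - η • gradient f (gd f η Θ₀ m)

/-! ### Constants attached to the initialization

Layers are numbered from `1` to `L` here, so `W_l` is `weight Θ₀ (l - 1)`. -/

/-- `σ_min(W_l)`. -/
def lamLow {L : ℕ} {n : ℕ → ℕ} (Θ₀ : Params L n) (l : ℕ) : ℝ :=
  sigmaMin (weight Θ₀ (l - 1))

/-- `2/3 (1 + σ_max(W_l))` for `l = 1, 2`, and `σ_max(W_l)` for `l ≥ 3`. -/
def lamBar {L : ℕ} {n : ℕ → ℕ} (Θ₀ : Params L n) (l : ℕ) : ℝ :=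
  if l ≤ 2 then 2 / 3 * (1 + sigmaMax (weight Θ₀ (l - 1))) else sigmaMax (weight Θ₀ (l - 1))

/-- The product of `σ_min(W_l)` over `3 ≤ l ≤ L`. -/
def lamLowProd {L : ℕ} {n : ℕ → ℕ} (Θ₀ : Params L n) : ℝ :=
  ∏ l ∈ Finset.Icc 3 L, lamLow Θ₀ l

/-- The product of `lamBar l` over `3 ≤ l ≤ L`. -/
def lamBarProd {L : ℕ} {n : ℕ → ℕ} (Θ₀ : Params L n) : ℝ :=
  ∏ l ∈ Finset.Icc 3 L, lamBar Θ₀ l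

/-- The smallest singular value of the first hidden layer output `a(H W_1)`. -/
def lamH {L N : ℕ} {n : ℕ → ℕ} (a : ℝ → ℝ) (H : Matrix (Fin N) (Fin (n 0)) ℝ)
    (Θ₀ : Params L n) : ℝ :=
  sigmaMin ((H * weight Θ₀ 0).map a)

/-- The threshold for the SCReLU parameter. -/
def alphaH {L N : ℕ} {n : ℕ → ℕ} (H : Matrix (Fin N) (Fin (n 0)) ℝ) (Θ₀ : Params L n) : ℝ :=
  (3 / 2) ^ L * (frobNorm H * ∏ l ∈ Finset.Icc 1 L, lamBar Θ₀ l)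

/-- The maximum of `2 λ̄₁ λ̄₂ / min_{3 ≤ l ≤ L} (λ_l λ̄_l)`, `λ̄₁` and `λ̄₂`;
the first term is absent if `L = 2`. -/
def lamMax {L : ℕ} {n : ℕ → ℕ} (Θ₀ : Params L n) : ℝ :=
  if hne : (Finset.Icc 3 L).Nonempty then
    max (2 * lamBar Θ₀ 1 * lamBar Θ₀ 2 /
        (Finset.Icc 3 L).inf' hne fun l => lamLow Θ₀ l * lamBar Θ₀ l)
      (max (lamBar Θ₀ 1) (lamBar Θ₀ 2))
  else max (lamBar Θ₀ 1) (lamBar Θ₀ 2)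

/-- The first initialization constant; `f₀` is the initial supervised loss. -/
def Lambda1 {L N : ℕ} {n : ℕ → ℕ} (γ α f₀ : ℝ) (H : Matrix (Fin N) (Fin (n 0)) ℝ)
    (Θ₀ : Params L n) : ℝ :=
  (γ ^ 4 / 3 * (6 / γ ^ 2) ^ L * frobNorm H * Real.sqrt (2 * f₀) *
    (lamBarProd Θ₀ / lamLowProd Θ₀ ^ 2) * Real.exp (2 * alphaH H Θ₀ / α) *
    lamMax Θ₀) ^ ((1 : ℝ) / 2)

/-- The second initialization constant; `f₀` is the initial supervised loss. -/
def Lambda2 {L N : ℕ} {n : ℕ → ℕ} (γ α f₀ : ℝ) (H : Matrix (Fin N) (Fin (n 0)) ℝ)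
    (Θ₀ : Params L n) : ℝ :=
  (2 * γ ^ 4 / 3 * (6 / γ ^ 2) ^ L * sigmaMax H * frobNorm H * Real.exp (2 * alphaH H Θ₀ / α) *
    Real.sqrt (2 * f₀) * (lamBarProd Θ₀ / lamLowProd Θ₀ ^ 2) *
    lamBar Θ₀ 2) ^ ((1 : ℝ) / 3)

/-- The rate constant. -/
def alpha0 {L N : ℕ} {n : ℕ → ℕ} (γ : ℝ) (a : ℝ → ℝ) (H : Matrix (Fin N) (Fin (n 0)) ℝ)
    (Θ₀ : Params L n) : ℝ :=
  Real.exp (-2) * γ ^ (2 * (L - 2)) * (1 / 2) ^ (2 * (L - 1)) *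
    lamLowProd Θ₀ ^ 2 * lamH a H Θ₀ ^ 2

end

end WSR

/-!
Both parts rest on one sufficient-decrease estimate. The losses are of class `C^{1,1}` near every
point of interest (continuously differentiable with a locally Lipschitz derivative), although not
`C²`, since neither the hidden activation nor the SCReLU has a second derivative. Near a compact set
the Lipschitz constants are uniform, so a short enough gradient step from any point of that set lowers
the loss by at least `η / 2` times the squared gradient norm (`exists_gradient_step_decrease`).

Unsupervised training: the bounded iterates with well-defined rates lie in a compact set on which the
loss is bounded below, so the squared gradient norms are summable
(`exists_tendsto_gradient_zero`).

Supervised training: backpropagation (`weight_gradient_lossSL`) writes the gradient with respect to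
the weight with index `l` as `F_lᵀ δ`, where `F_l` is the input of that weight and `δ` is the residual
pulled back through the later layers. As long as each weight matrix stays within its `travelRadius` of
the initial one,

* `δ` at the second weight matrix is bounded below, because the matrices from the third on have smallest
  singular value at least half the initial one, the hidden slopes are at least `γ`, and the slope of
  the SCReLU is at least `exp (-alphaH / α)` on the attained pre-activations. Since the number of
  samples is at most the first hidden width, `F_1ᵀ` is bounded below as well, and the second weight
  matrix alone gives the Polyak–Łojasiewicz inequality (`polyak_lojasiewicz_lossSL`);
* each block of the gradient is at most a constant times the norm of the residual
  (`norm_weight_gradient_lossSL_le`).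

The Polyak–Łojasiewicz inequality and the sufficient decrease make the loss decay geometrically, hence
so do the lengths of the steps. The displacement of each weight matrix is thus at most a geometric
series, which the conditions on `Lambda1` and `Lambda2` keep within the travel radius
(`two_mul_alphaH_div_le`, `sigmaMax_mul_travelRadius_zero_le`). The region is therefore never left, and
the iterates form a Cauchy sequence whose limit has zero loss
(`exists_gradient_descent_linear_convergence`).
-/

namespace WSR

open Filter Topology
open scoped NNReal

/-! ### Functions with a locally Lipschitz derivative -/

section Calculus

variable {X Y Z : Type*} [PseudoEMetricSpace X] [PseudoEMetricSpace Y] [PseudoEMetricSpace Z]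

/-- `f` is Lipschitz on some neighbourhood of `x`. -/
def LipschitzNear (f : X → Y) (x : X) : Prop :=
  ∃ K : ℝ≥0, ∃ t ∈ 𝓝 x, LipschitzOnWith K f t

lemma LipschitzNear.continuousAt {f : X → Y} {x : X} (hf : LipschitzNear f x) :
    ContinuousAt f x := by
  obtain ⟨K, t, ht, h⟩ := hf
  exact h.continuousOn.continuousAt ht

lemma LipschitzNear.comp {g : Y → Z} {f : X → Y} {x : X} (hg : LipschitzNear g (f x))
    (hf : LipschitzNear f x) : LipschitzNear (fun y => g (f y)) x := by
  have hc := hf.continuousAt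
  obtain ⟨K, t, ht, h⟩ := hf
  obtain ⟨K', t', ht', h'⟩ := hg
  refine ⟨K' * K, t ∩ f ⁻¹' t', inter_mem ht (hc ht'), ?_⟩
  exact h'.comp (h.mono Set.inter_subset_left) fun y hy => hy.2

lemma LipschitzNear.prodMk {f : X → Y} {g : X → Z} {x : X} (hf : LipschitzNear f x)
    (hg : LipschitzNear g x) : LipschitzNear (fun y => (f y, g y)) x := by
  obtain ⟨K, t, ht, h⟩ := hf
  obtain ⟨K', t', ht', h'⟩ := hg
  exact ⟨max K K', t ∩ t', inter_mem ht ht',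
    (h.mono Set.inter_subset_left).prodMk (h'.mono Set.inter_subset_right)⟩

lemma LipschitzNear.congr {f g : X → Y} {x : X} (hf : LipschitzNear f x) (h : f =ᶠ[𝓝 x] g) :
    LipschitzNear g x := by
  obtain ⟨K, t, ht, hK⟩ := hf
  refine ⟨K, t ∩ {y | f y = g y}, inter_mem ht h, fun y hy z hz => ?_⟩
  rw [← show f y = g y from hy.2, ← show f z = g z from hz.2]
  exact hK hy.1 hz.1

variable {E F G : Type*} [NormedAddCommGroup E] [NormedSpace ℝ E]
  [NormedAddCommGroup F] [NormedSpace ℝ F] [NormedAddCommGroup G] [NormedSpace ℝ G]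

lemma lipschitzNear_of_contDiffAt {f : E → F} {x : E} (hf : ContDiffAt ℝ 1 f x) :
    LipschitzNear f x :=
  hf.exists_lipschitzOnWith

/-- `f` is `C^{1,1}` near `x`: continuously differentiable with a Lipschitz derivative. -/
structure C11At (f : E → F) (x : E) : Prop where
  contDiffAt : ContDiffAt ℝ 1 f x
  lipschitzNear_fderiv : LipschitzNear (fderiv ℝ f) x

lemma c11At_of_contDiffAt {f : E → F} {x : E} (hf : ContDiffAt ℝ 2 f x) : C11At f x :=
  ⟨hf.of_le one_le_two, lipschitzNear_of_contDiffAt (hf.fderiv_right (m := 1) (by norm_num))⟩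

lemma C11At.eventually_differentiableAt {f : E → F} {x : E} (hf : C11At f x) :
    ∀ᶠ y in 𝓝 x, DifferentiableAt ℝ f y :=
  (hf.contDiffAt.eventually (by simp)).mono fun _ h => h.differentiableAt (by simp)

lemma C11At.differentiableAt {f : E → F} {x : E} (hf : C11At f x) : DifferentiableAt ℝ f x :=
  hf.contDiffAt.differentiableAt (by simp)

lemma C11At.comp {g : F → G} {f : E → F} {x : E} (hg : C11At g (f x)) (hf : C11At f x) :
    C11At (fun y => g (f y)) x := by
  refine ⟨hg.contDiffAt.comp x hf.contDiffAt, ?_⟩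
  have h1 : LipschitzNear (fun y => (fderiv ℝ g (f y)).comp (fderiv ℝ f y)) x := by
    have hb : ContDiff ℝ 1 fun p : (F →L[ℝ] G) × (E →L[ℝ] F) => p.1.comp p.2 :=
      isBoundedBilinearMap_comp.contDiff
    have h2 : LipschitzNear (fun y => fderiv ℝ g (f y)) x :=
      LipschitzNear.comp hg.lipschitzNear_fderiv (lipschitzNear_of_contDiffAt hf.contDiffAt)
    have h3 : LipschitzNear (fun p : (F →L[ℝ] G) × (E →L[ℝ] F) => p.1.comp p.2)
        (fderiv ℝ g (f x), fderiv ℝ f x) := lipschitzNear_of_contDiffAt hb.contDiffAt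
    exact LipschitzNear.comp (f := fun y => (fderiv ℝ g (f y), fderiv ℝ f y)) h3
      (h2.prodMk hf.lipschitzNear_fderiv)
  refine h1.congr ?_
  filter_upwards [hf.eventually_differentiableAt,
    hf.contDiffAt.continuousAt.eventually hg.eventually_differentiableAt] with y h2 h3
  exact (fderiv_comp y h3 h2).symm

lemma C11At.prodMk {f : E → F} {g : E → G} {x : E} (hf : C11At f x) (hg : C11At g x) :
    C11At (fun y => (f y, g y)) x := by
  refine ⟨hf.contDiffAt.prodMk hg.contDiffAt, ?_⟩
  have h1 : LipschitzNear (fun y => (fderiv ℝ f y).prod (fderiv ℝ g y)) x := by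
    have hb : ContDiff ℝ 1 fun p : (E →L[ℝ] F) × (E →L[ℝ] G) => p.1.prod p.2 :=
      (ContinuousLinearMap.prodₗᵢ (𝕜 := ℝ) ℝ (E := E) (F := F) (G := G)).contDiff
    have h3 : LipschitzNear (fun p : (E →L[ℝ] F) × (E →L[ℝ] G) => p.1.prod p.2)
        (fderiv ℝ f x, fderiv ℝ g x) := lipschitzNear_of_contDiffAt hb.contDiffAt
    exact LipschitzNear.comp (f := fun y => (fderiv ℝ f y, fderiv ℝ g y)) h3
      (hf.lipschitzNear_fderiv.prodMk hg.lipschitzNear_fderiv)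
  refine h1.congr ?_
  filter_upwards [hf.eventually_differentiableAt, hg.eventually_differentiableAt] with y h2 h3
  exact (h2.fderiv_prodMk h3).symm

lemma c11At_const (c : F) (x : E) : C11At (fun _ : E => c) x :=
  c11At_of_contDiffAt contDiffAt_const

lemma C11At.add {f g : E → F} {x : E} (hf : C11At f x) (hg : C11At g x) :
    C11At (fun y => f y + g y) x :=
  C11At.comp (g := fun p : F × F => p.1 + p.2)
    (c11At_of_contDiffAt (contDiff_fst.add contDiff_snd).contDiffAt) (hf.prodMk hg)

lemma C11At.neg {f : E → F} {x : E} (hf : C11At f x) : C11At (fun y => -f y) x :=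
  C11At.comp (g := fun p : F => -p) (c11At_of_contDiffAt contDiff_neg.contDiffAt) hf

lemma C11At.mul {f g : E → ℝ} {x : E} (hf : C11At f x) (hg : C11At g x) :
    C11At (fun y => f y * g y) x :=
  C11At.comp (g := fun p : ℝ × ℝ => p.1 * p.2)
    (c11At_of_contDiffAt (contDiff_fst.mul contDiff_snd).contDiffAt) (hf.prodMk hg)

lemma C11At.sum {ι : Type*} (s : Finset ι) {f : ι → E → F} {x : E}
    (hf : ∀ i ∈ s, C11At (f i) x) : C11At (fun y => ∑ i ∈ s, f i y) x := by
  classical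
  induction s using Finset.induction_on with
  | empty => simpa using c11At_const (0 : F) x
  | insert i s hi ih =>
    simp only [Finset.sum_insert hi]
    exact (hf i (Finset.mem_insert_self i s)).add
      (ih fun j hj => hf j (Finset.mem_insert_of_mem hj))

lemma c11At_of_lipschitzWith_deriv {f : ℝ → ℝ} {K : ℝ≥0} (hf : Differentiable ℝ f)
    (hK : LipschitzWith K (deriv f)) (x : ℝ) : C11At f x := by
  refine ⟨(contDiff_one_iff_deriv.2 ⟨hf, hK.continuous⟩).contDiffAt, ?_⟩
  have hb : ContDiff ℝ 1 fun c : ℝ => c • (1 : ℝ →L[ℝ] ℝ) := contDiff_id.smul contDiff_const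
  have h1 := LipschitzNear.comp (lipschitzNear_of_contDiffAt hb.contDiffAt)
    (⟨K, Set.univ, univ_mem, hK.lipschitzOnWith⟩ : LipschitzNear (deriv f) x)
  refine h1.congr (Eventually.of_forall fun y => ?_)
  ext
  simp

end Calculus

/-! ### Gradient descent along a compact set -/

section Descent

variable {E : Type*} [NormedAddCommGroup E]

/-- On a compact set, the local Lipschitz constants of the derivative and the sizes of the
neighbourhoods they belong to can be chosen uniformly. No convexity is needed, since the second
point is only required to be close to the compact set. -/
lemma exists_uniform_lipschitz_fderiv [NormedSpace ℝ E] {f : E → ℝ} {C : Set E}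
    (hC : IsCompact C) (hf : ∀ x ∈ C, C11At f x) :
    ∃ r : ℝ, 0 < r ∧ ∃ Q : ℝ, 0 ≤ Q ∧ ∀ x ∈ C, ∀ y, ‖y - x‖ < r →
      DifferentiableAt ℝ f y ∧ ‖fderiv ℝ f y - fderiv ℝ f x‖ ≤ Q * ‖y - x‖ := by
  refine hC.induction_on (p := fun S => ∃ r : ℝ, 0 < r ∧ ∃ Q : ℝ, 0 ≤ Q ∧ ∀ x ∈ S, ∀ y,
      ‖y - x‖ < r → DifferentiableAt ℝ f y ∧ ‖fderiv ℝ f y - fderiv ℝ f x‖ ≤ Q * ‖y - x‖)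
    ⟨1, one_pos, 0, le_rfl, by simp⟩ ?_ ?_ ?_
  · rintro s t hst ⟨r, hr, Q, hQ, h⟩
    exact ⟨r, hr, Q, hQ, fun x hx => h x (hst hx)⟩
  · rintro s t ⟨r, hr, Q, hQ, h⟩ ⟨r', hr', Q', hQ', h'⟩
    refine ⟨min r r', lt_min hr hr', max Q Q', le_max_of_le_left hQ, ?_⟩
    rintro x (hx | hx) y hy
    · obtain ⟨h1, h2⟩ := h x hx y (hy.trans_le (min_le_left _ _))
      exact ⟨h1, h2.trans (by gcongr; exact le_max_left _ _)⟩
    · obtain ⟨h1, h2⟩ := h' x hx y (hy.trans_le (min_le_right _ _))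
      exact ⟨h1, h2.trans (by gcongr; exact le_max_right _ _)⟩
  · intro x hx
    obtain ⟨K, t, ht, hK⟩ := (hf x hx).lipschitzNear_fderiv
    obtain ⟨r, hr, hrt⟩ := Metric.mem_nhds_iff.1
      (inter_mem ht (hf x hx).eventually_differentiableAt)
    refine ⟨Metric.ball x (r / 2), mem_nhdsWithin_of_mem_nhds (Metric.ball_mem_nhds _ (by linarith)),
      r / 2, by linarith, K, K.2, fun y hy z hz => ?_⟩
    have hy' : dist y x < r / 2 := hy
    have hz' : dist z y < r / 2 := by rwa [dist_eq_norm]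
    have h1 := hrt (show y ∈ Metric.ball x r by rw [Metric.mem_ball]; linarith)
    have h2 := hrt (show z ∈ Metric.ball x r by
      rw [Metric.mem_ball]; linarith [dist_triangle z y x])
    refine ⟨h2.2, ?_⟩
    have := hK.dist_le_mul z h2.1 y h1.1
    rwa [dist_eq_norm, dist_eq_norm] at this

variable [InnerProductSpace ℝ E] [CompleteSpace E]

/-- Sufficient decrease: for small steps, one gradient step started anywhere in a compact set
decreases the function by at least half the step size times the squared gradient norm. -/
theorem exists_gradient_step_decrease {f : E → ℝ} {C : Set E}
    (hC : IsCompact C) (hf : ∀ x ∈ C, C11At f x) :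
    ∃ ηbar : ℝ, 0 < ηbar ∧ ∀ η : ℝ, 0 < η → η < ηbar → ∀ x ∈ C,
      f (x - η • gradient f x) ≤ f x - η / 2 * ‖gradient f x‖ ^ 2 := by
  obtain ⟨r, hr, Q, hQ, h⟩ := exists_uniform_lipschitz_fderiv hC hf
  have hnorm : ∀ x, ‖gradient f x‖ = ‖fderiv ℝ f x‖ := fun x => by simp [gradient]
  have hcont : ContinuousOn (fun x => ‖gradient f x‖) C := fun x hx => by
    simp only [hnorm]
    exact (hf x hx).lipschitzNear_fderiv.continuousAt.norm.continuousWithinAt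
  obtain ⟨G, hG⟩ := hC.bddAbove_image hcont
  have hG' : ∀ x ∈ C, ‖gradient f x‖ ≤ max G 1 := fun x hx =>
    (hG ⟨x, hx, rfl⟩).trans (le_max_left _ _)
  have hM : 0 < max G 1 := lt_max_of_lt_right one_pos
  refine ⟨min (r / max G 1) (1 / (2 * (Q + 1))), by positivity, fun η hη hlt x hx => ?_⟩
  set g := gradient f x with hg
  have hgr : ‖-(η • g)‖ < r := by
    rw [norm_neg, norm_smul, Real.norm_of_nonneg hη.le]
    calc η * ‖g‖ ≤ η * max G 1 := by gcongr; exact hG' x hx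
      _ < r := (lt_div_iff₀ hM).1 (hlt.trans_le (min_le_left _ _))
  have hηQ : η * Q ≤ 1 / 2 := by
    have := (lt_div_iff₀ (by positivity : (0 : ℝ) < 2 * (Q + 1))).1
      (hlt.trans_le (min_le_right _ _))
    nlinarith
  -- the mean value inequality for `f - f'(x)` on the segment from `x` to the next iterate
  have key := (convex_segment x (x - η • g)).norm_image_sub_le_of_norm_hasFDerivWithin_le
    (f := fun y => f y - fderiv ℝ f x y) (f' := fun y => fderiv ℝ f y - fderiv ℝ f x)
    (C := Q * ‖-(η • g)‖) (x := x) (y := x - η • g) ?_ ?_ (left_mem_segment _ _ _)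
    (right_mem_segment _ _ _)
  · have hin : fderiv ℝ f x (x - η • g) = fderiv ℝ f x x - η * ‖g‖ ^ 2 := by
      have : fderiv ℝ f x g = ‖g‖ ^ 2 := by
        rw [← real_inner_self_eq_norm_sq, hg, inner_gradient_left]
      rw [map_sub, map_smul, this, smul_eq_mul]
    rw [sub_sub_cancel_left, norm_neg, norm_smul, Real.norm_of_nonneg hη.le] at key
    have h2 := (le_abs_self _).trans key
    simp only [hin] at h2
    have : Q * (η * ‖g‖) * (η * ‖g‖) ≤ 1 / 2 * (η * ‖g‖ ^ 2) := by
      have : Q * (η * ‖g‖) * (η * ‖g‖) = (η * Q) * (η * ‖g‖ ^ 2) := by ring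
      rw [this]
      gcongr
    linarith
  · intro y hy
    have hy' : ‖y - x‖ ≤ ‖-(η • g)‖ := by
      obtain ⟨t, ht, rfl⟩ := (segment_eq_image' ℝ x (x - η • g)) ▸ hy
      rw [add_sub_cancel_left, sub_sub_cancel_left, norm_smul, Real.norm_of_nonneg ht.1]
      exact mul_le_of_le_one_left (norm_nonneg _) ht.2
    exact ((h x hx y (hy'.trans_lt hgr)).1.hasFDerivAt.sub
      (fderiv ℝ f x).hasFDerivAt).hasFDerivWithinAt
  · intro y hy
    have hy' : ‖y - x‖ ≤ ‖-(η • g)‖ := by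
      obtain ⟨t, ht, rfl⟩ := (segment_eq_image' ℝ x (x - η • g)) ▸ hy
      rw [add_sub_cancel_left, sub_sub_cancel_left, norm_smul, Real.norm_of_nonneg ht.1]
      exact mul_le_of_le_one_left (norm_nonneg _) ht.2
    exact (h x hx y (hy'.trans_lt hgr)).2.trans (by gcongr)

end Descent

end WSR

namespace WSR

/-! ### Singular values and the Frobenius norm -/

section SingularValues

open LinearMap Module
open scoped Matrix.Norms.Frobenius

variable {E F : Type*} [NormedAddCommGroup E] [InnerProductSpace ℝ E] [FiniteDimensional ℝ E]
  [NormedAddCommGroup F] [InnerProductSpace ℝ F] [FiniteDimensional ℝ F]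

/-- Right singular vectors: an orthonormal basis whose image under `T` is orthogonal, with norms the
singular values of `T`. -/
lemma exists_orthonormalBasis_inner_map (T : E →ₗ[ℝ] F) {d : ℕ} (hd : finrank ℝ E = d) :
    ∃ v : OrthonormalBasis (Fin d) ℝ E, ∀ i j,
      inner ℝ (T (v i)) (T (v j)) = if i = j then T.singularValues i ^ 2 else 0 := by
  refine ⟨T.isSymmetric_adjoint_comp_self.eigenvectorBasis hd, fun i j => ?_⟩
  rw [← LinearMap.adjoint_inner_right, ← LinearMap.comp_apply,
    LinearMap.IsSymmetric.apply_eigenvectorBasis, inner_smul_right,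
    orthonormal_iff_ite.1 (OrthonormalBasis.orthonormal _) i j, T.sq_singularValues_fin hd]
  by_cases h : i = j
  · subst h; simp
  · simp [h]

lemma exists_orthonormalBasis_norm_map_sq (T : E →ₗ[ℝ] F) {d : ℕ} (hd : finrank ℝ E = d) :
    ∃ v : OrthonormalBasis (Fin d) ℝ E, ∀ x,
      ‖T x‖ ^ 2 = ∑ i : Fin d, T.singularValues i ^ 2 * inner ℝ (v i) x ^ 2 := by
  obtain ⟨v, hv⟩ := exists_orthonormalBasis_inner_map T hd
  refine ⟨v, fun x => ?_⟩
  conv_lhs => rw [← v.sum_repr' x, map_sum, ← real_inner_self_eq_norm_sq, sum_inner]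
  refine Finset.sum_congr rfl fun i _ => ?_
  rw [inner_sum, Finset.sum_eq_single i]
  · rw [map_smul, inner_smul_left, inner_smul_right, hv i i]
    simp
    ring
  · intro j _ hj
    rw [map_smul, map_smul, inner_smul_left, inner_smul_right, hv i j, if_neg (Ne.symm hj)]
    simp
  · simp

lemma norm_map_le_singularValues_zero (T : E →ₗ[ℝ] F) (x : E) :
    ‖T x‖ ≤ T.singularValues 0 * ‖x‖ := by
  obtain ⟨v, hv⟩ := exists_orthonormalBasis_norm_map_sq T rfl
  refine le_of_sq_le_sq ?_ (mul_nonneg (T.singularValues_nonneg 0) (norm_nonneg x))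
  rw [hv, mul_pow, ← v.sum_sq_inner_right x, Finset.mul_sum]
  refine Finset.sum_le_sum fun i _ => ?_
  have := T.singularValues_antitone (Nat.zero_le i)
  have := T.singularValues_nonneg i
  gcongr

lemma norm_adjoint_le_singularValues_zero (T : E →ₗ[ℝ] F) (y : F) :
    ‖LinearMap.adjoint T y‖ ≤ T.singularValues 0 * ‖y‖ := by
  set z := LinearMap.adjoint T y
  have h1 : ‖z‖ * ‖z‖ ≤ (T.singularValues 0 * ‖y‖) * ‖z‖ := by
    calc ‖z‖ * ‖z‖ = inner ℝ (T z) y := by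
          rw [← real_inner_self_eq_norm_mul_norm]
          exact LinearMap.adjoint_inner_right T z y
      _ ≤ ‖T z‖ * ‖y‖ := real_inner_le_norm _ _
      _ ≤ T.singularValues 0 * ‖z‖ * ‖y‖ := by gcongr; exact norm_map_le_singularValues_zero T z
      _ = _ := by ring
  rcases (norm_nonneg z).eq_or_lt with h | h
  · rw [← h]; exact mul_nonneg (T.singularValues_nonneg 0) (norm_nonneg y)
  · exact le_of_mul_le_mul_right h1 h

lemma singularValues_mul_norm_le (T : E →ₗ[ℝ] F) {s : ℕ} (hs : finrank ℝ E ≤ s + 1) (x : E) :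
    T.singularValues s * ‖x‖ ≤ ‖T x‖ := by
  obtain ⟨v, hv⟩ := exists_orthonormalBasis_norm_map_sq T rfl
  refine le_of_sq_le_sq ?_ (norm_nonneg _)
  rw [hv, mul_pow, ← v.sum_sq_inner_right x, Finset.mul_sum]
  refine Finset.sum_le_sum fun i _ => ?_
  have := T.singularValues_antitone (show (i : ℕ) ≤ s by omega)
  have := T.singularValues_nonneg s
  gcongr

/-- If `T` has `dim F` nonzero singular values, the images of the corresponding right singular
vectors form an orthogonal basis of `F`, and the adjoint is bounded below by the smallest of these
singular values. -/
lemma singularValues_mul_norm_le_adjoint (T : E →ₗ[ℝ] F) {s : ℕ} (hs : finrank ℝ F = s + 1)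
    (hle : finrank ℝ F ≤ finrank ℝ E) (y : F) :
    T.singularValues s * ‖y‖ ≤ ‖LinearMap.adjoint T y‖ := by
  rcases (T.singularValues_nonneg s).eq_or_lt with h0 | hpos
  · rw [← h0, zero_mul]; exact norm_nonneg _
  obtain ⟨v, hv⟩ := exists_orthonormalBasis_inner_map T rfl
  have hσ : ∀ i : Fin (s + 1), T.singularValues s ≤ T.singularValues i := fun i =>
    T.singularValues_antitone (by omega)
  have hσ' : ∀ i : Fin (s + 1), 0 < T.singularValues i := fun i => hpos.trans_le (hσ i)
  let c : Fin (s + 1) → Fin (finrank ℝ E) := Fin.castLE (hs ▸ hle)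
  have hc : Function.Injective c := Fin.castLE_injective _
  let u : Fin (s + 1) → F := fun i => (T.singularValues i)⁻¹ • T (v (c i))
  have hu : Orthonormal ℝ u := by
    rw [orthonormal_iff_ite]
    intro i j
    simp only [u, inner_smul_left, inner_smul_right, hv, hc.eq_iff]
    by_cases h : i = j
    · subst h
      have := (hσ' i).ne'
      simp only [c, Fin.val_castLE, if_true]
      simp
      field_simp
    · simp [h]
  have hcard : Fintype.card (Fin (s + 1)) = finrank ℝ F := by simp [hs]
  let B : OrthonormalBasis (Fin (s + 1)) ℝ F :=
    (basisOfOrthonormalOfCardEqFinrank hu hcard).toOrthonormalBasis (by simpa using hu)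
  have hB : ∀ i, B i = u i := fun i => by simp [B]
  refine le_of_sq_le_sq ?_ (norm_nonneg _)
  rw [mul_pow, ← B.sum_sq_inner_right y, ← v.sum_sq_inner_right (LinearMap.adjoint T y),
    Finset.mul_sum]
  calc ∑ i, T.singularValues s ^ 2 * inner ℝ (B i) y ^ 2
      ≤ ∑ i, inner ℝ (v (c i)) (LinearMap.adjoint T y) ^ 2 := by
        refine Finset.sum_le_sum fun i _ => ?_
        have h1 : inner ℝ (v (c i)) (LinearMap.adjoint T y)
            = T.singularValues i * inner ℝ (B i) y := by
          have := (hσ' i).ne'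
          rw [LinearMap.adjoint_inner_right, hB, inner_smul_left]
          simp
          field_simp
        rw [h1, mul_pow]
        have := hσ i
        gcongr
    _ = ∑ k ∈ Finset.univ.map ⟨c, hc⟩, inner ℝ (v k) (LinearMap.adjoint T y) ^ 2 := by
        rw [Finset.sum_map]; rfl
    _ ≤ _ := Finset.sum_le_sum_of_subset_of_nonneg (Finset.subset_univ _)
        fun _ _ _ => sq_nonneg _

variable {p q m : ℕ}

lemma frobenius_norm_sq (A : Matrix (Fin p) (Fin q) ℝ) : ‖A‖ ^ 2 = ∑ i, ∑ j, A i j ^ 2 := by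
  rw [Matrix.frobenius_norm_def, ← Real.sqrt_eq_rpow, Real.sq_sqrt (by positivity)]
  simp

lemma frobNorm_eq_norm (A : Matrix (Fin p) (Fin q) ℝ) : frobNorm A = ‖A‖ := by
  rw [frobNorm, ← frobenius_norm_sq, Real.sqrt_sq (norm_nonneg _)]

lemma frobenius_norm_sq_rows (A : Matrix (Fin p) (Fin q) ℝ) :
    ‖A‖ ^ 2 = ∑ i, ‖WithLp.toLp 2 (A i)‖ ^ 2 := by
  simp [frobenius_norm_sq, EuclideanSpace.norm_sq_eq]

lemma toLp_row_mul_transpose (X : Matrix (Fin m) (Fin q) ℝ) (A : Matrix (Fin p) (Fin q) ℝ)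
    (i : Fin m) :
    WithLp.toLp 2 ((X * A.transpose) i) = Matrix.toEuclideanLin A (WithLp.toLp 2 (X i)) := by
  ext j
  simp [Matrix.mul_apply, Matrix.mulVec, dotProduct, mul_comm]

/-- If a matrix acts on each row of `X` with expansion at most `c`, it does so on the Frobenius
norm. -/
lemma norm_mul_transpose_le {c : ℝ} (A : Matrix (Fin p) (Fin q) ℝ) (hc : 0 ≤ c)
    (h : ∀ x, ‖Matrix.toEuclideanLin A x‖ ≤ c * ‖x‖) (X : Matrix (Fin m) (Fin q) ℝ) :
    ‖X * A.transpose‖ ≤ c * ‖X‖ := by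
  refine le_of_sq_le_sq ?_ (by positivity)
  rw [mul_pow, frobenius_norm_sq_rows, frobenius_norm_sq_rows, Finset.mul_sum]
  refine Finset.sum_le_sum fun i _ => ?_
  rw [← mul_pow, toLp_row_mul_transpose]
  gcongr
  exact h _

lemma le_norm_mul_transpose {c : ℝ} (A : Matrix (Fin p) (Fin q) ℝ) (hc : 0 ≤ c)
    (h : ∀ x, c * ‖x‖ ≤ ‖Matrix.toEuclideanLin A x‖) (X : Matrix (Fin m) (Fin q) ℝ) :
    c * ‖X‖ ≤ ‖X * A.transpose‖ := by
  refine le_of_sq_le_sq ?_ (by positivity)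
  rw [mul_pow, frobenius_norm_sq_rows, frobenius_norm_sq_rows, Finset.mul_sum]
  refine Finset.sum_le_sum fun i _ => ?_
  rw [← mul_pow, toLp_row_mul_transpose]
  gcongr
  exact h _

lemma sigmaMax_nonneg (A : Matrix (Fin p) (Fin q) ℝ) : 0 ≤ sigmaMax A :=
  LinearMap.singularValues_nonneg _ _

lemma sigmaMin_nonneg (A : Matrix (Fin p) (Fin q) ℝ) : 0 ≤ sigmaMin A :=
  LinearMap.singularValues_nonneg _ _

lemma sigmaMin_le_sigmaMax (A : Matrix (Fin p) (Fin q) ℝ) : sigmaMin A ≤ sigmaMax A :=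
  LinearMap.singularValues_antitone _ (Nat.zero_le _)

lemma toEuclideanLin_transpose (A : Matrix (Fin p) (Fin q) ℝ) :
    Matrix.toEuclideanLin A.transpose = LinearMap.adjoint (Matrix.toEuclideanLin A) := by
  rw [← Matrix.toEuclideanLin_conjTranspose_eq_adjoint,
    Matrix.conjTranspose_eq_transpose_of_trivial]

lemma norm_mul_transpose_le_sigmaMax (X : Matrix (Fin m) (Fin q) ℝ)
    (A : Matrix (Fin p) (Fin q) ℝ) : ‖X * A.transpose‖ ≤ sigmaMax A * ‖X‖ :=
  norm_mul_transpose_le A (sigmaMax_nonneg A) (norm_map_le_singularValues_zero _) X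

lemma norm_mul_le_sigmaMax (X : Matrix (Fin m) (Fin p) ℝ) (A : Matrix (Fin p) (Fin q) ℝ) :
    ‖X * A‖ ≤ sigmaMax A * ‖X‖ := by
  have := norm_mul_transpose_le A.transpose (sigmaMax_nonneg A) (fun x => by
    rw [toEuclideanLin_transpose]; exact norm_adjoint_le_singularValues_zero _ x) X
  rwa [Matrix.transpose_transpose] at this

lemma norm_mul_le_sigmaMax_left (A : Matrix (Fin p) (Fin q) ℝ) (X : Matrix (Fin q) (Fin m) ℝ) :
    ‖A * X‖ ≤ sigmaMax A * ‖X‖ := by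
  have := norm_mul_transpose_le_sigmaMax X.transpose A
  rwa [← Matrix.transpose_mul, Matrix.frobenius_norm_transpose,
    Matrix.frobenius_norm_transpose] at this

lemma sigmaMin_mul_norm_le_norm_mul_transpose (hqp : q ≤ p) (X : Matrix (Fin m) (Fin q) ℝ)
    (A : Matrix (Fin p) (Fin q) ℝ) : sigmaMin A * ‖X‖ ≤ ‖X * A.transpose‖ :=
  le_norm_mul_transpose A (sigmaMin_nonneg A)
    (singularValues_mul_norm_le _ (by rw [finrank_euclideanSpace_fin]; omega)) X

lemma sigmaMin_mul_norm_le_norm_transpose_mul (hp : 0 < p) (hpq : p ≤ q)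
    (A : Matrix (Fin p) (Fin q) ℝ) (X : Matrix (Fin p) (Fin m) ℝ) :
    sigmaMin A * ‖X‖ ≤ ‖A.transpose * X‖ := by
  have := le_norm_mul_transpose A.transpose (sigmaMin_nonneg A) (fun x => by
    rw [toEuclideanLin_transpose]
    exact singularValues_mul_norm_le_adjoint _ (by rw [finrank_euclideanSpace_fin]; omega)
      (by simpa using hpq) x) X.transpose
  rwa [← Matrix.transpose_mul, Matrix.frobenius_norm_transpose,
    Matrix.frobenius_norm_transpose] at this

end SingularValues

end WSR

namespace WSR

open Filter Topology
open scoped NNReal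

/-! ### The smoothed clipped ReLU -/

section Screlu

/-- The function equal to `exp (t / α)` for `t ≤ 0` and to `1` for `t ≥ 0`. -/
noncomputable def clippedExp (α t : ℝ) : ℝ := Real.exp (min t 0 / α)

lemma clippedExp_le_one {α : ℝ} (hα : 0 < α) (t : ℝ) : clippedExp α t ≤ 1 :=
  Real.exp_le_one_iff.2 (div_nonpos_of_nonpos_of_nonneg (min_le_right _ _) hα.le)

lemma clippedExp_of_nonneg {α t : ℝ} (ht : 0 ≤ t) : clippedExp α t = 1 := by
  simp [clippedExp, min_eq_right ht]

lemma abs_exp_sub_exp_le {u v : ℝ} (hu : u ≤ 0) (hv : v ≤ 0) :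
    |Real.exp u - Real.exp v| ≤ |u - v| := by
  wlog h : v ≤ u generalizing u v
  · rw [abs_sub_comm, abs_sub_comm u v]
    exact this hv hu (le_of_not_ge h)
  rw [abs_of_nonneg (sub_nonneg.2 (Real.exp_le_exp.2 h)), abs_of_nonneg (sub_nonneg.2 h)]
  have h1 : Real.exp v = Real.exp u * Real.exp (v - u) := by rw [← Real.exp_add]; ring_nf
  have h2 := Real.add_one_le_exp (v - u)
  have h3 := Real.exp_le_one_iff.2 hu
  have h4 := Real.exp_pos u
  rw [h1]
  nlinarith

lemma abs_clippedExp_sub_le {α : ℝ} (hα : 0 < α) (s t : ℝ) :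
    |clippedExp α s - clippedExp α t| ≤ 1 / α * |s - t| := by
  have h := abs_exp_sub_exp_le (u := min s 0 / α) (v := min t 0 / α)
    (div_nonpos_of_nonpos_of_nonneg (min_le_right _ _) hα.le)
    (div_nonpos_of_nonpos_of_nonneg (min_le_right _ _) hα.le)
  refine h.trans ?_
  rw [← sub_div, abs_div, abs_of_pos hα, div_eq_inv_mul, one_div]
  have := abs_min_sub_min_le_max s 0 t 0
  rw [sub_zero, abs_zero, max_eq_left (abs_nonneg _)] at this
  gcongr

/-- The deviation of the SCReLU from the identity, to the left of `0`. -/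
noncomputable def screluTail (α t : ℝ) : ℝ := α * (Real.exp (min t 0 / α) - 1) - min t 0

lemma hasDerivAt_screluTail {α : ℝ} (hα : 0 < α) (t : ℝ) :
    HasDerivAt (screluTail α) (clippedExp α t - 1) t := by
  have hexp : ∀ s : ℝ, HasDerivAt (fun s => α * (Real.exp (s / α) - 1) - s)
      (Real.exp (s / α) - 1) s := fun s => by
    have h := ((((hasDerivAt_id s).div_const α).exp.sub_const 1).const_mul α).sub (hasDerivAt_id s)
    convert! h using 1
    simp
    field_simp
  have hleft : ∀ s ≤ 0, screluTail α s = α * (Real.exp (s / α) - 1) - s := fun s hs => by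
    rw [screluTail, min_eq_left hs]
  have hright : ∀ s, 0 ≤ s → screluTail α s = 0 := fun s hs => by
    simp [screluTail, min_eq_right hs]
  rcases lt_trichotomy t 0 with ht | rfl | ht
  · rw [clippedExp, min_eq_left ht.le]
    refine (hexp t).congr_of_eventuallyEq ?_
    filter_upwards [Iio_mem_nhds ht] with s hs using hleft s (le_of_lt hs)
  · have h1 : HasDerivWithinAt (screluTail α) (clippedExp α 0 - 1) (Set.Iic 0) 0 := by
      have h := (hexp 0).hasDerivWithinAt (s := Set.Iic 0)
      refine (h.congr hleft (hleft 0 le_rfl)).congr_deriv ?_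
      simp [clippedExp]
    have h2 : HasDerivWithinAt (screluTail α) (clippedExp α 0 - 1) (Set.Ici 0) 0 := by
      rw [clippedExp_of_nonneg le_rfl, sub_self]
      exact (hasDerivWithinAt_const 0 (Set.Ici 0) (0 : ℝ)).congr hright (hright 0 le_rfl)
    rw [← hasDerivWithinAt_univ, ← Set.Iic_union_Ici (a := (0 : ℝ))]
    exact h1.union h2
  · rw [clippedExp_of_nonneg ht.le, sub_self]
    refine (hasDerivAt_const t (0 : ℝ)).congr_of_eventuallyEq ?_
    filter_upwards [Ioi_mem_nhds ht] with s hs using hright s (le_of_lt hs)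

lemma screlu_eq {P : ℝ} (hP : 0 < P) (α x : ℝ) :
    screlu α P x = x + screluTail α x - screluTail α (P - x) := by
  unfold screlu screluTail
  split_ifs with h1 h2
  · rw [min_eq_left h1.le, min_eq_right (by linarith : 0 ≤ P - x), one_div_mul_eq_div,
      zero_div, Real.exp_zero]
    ring
  · rw [min_eq_right (not_lt.1 h1), min_eq_right (by linarith : 0 ≤ P - x)]
    simp
  · rw [min_eq_right (not_lt.1 h1), min_eq_left (by linarith : P - x ≤ 0)]
    simp
    ring

lemma hasDerivAt_screlu {α P : ℝ} (hα : 0 < α) (hP : 0 < P) (x : ℝ) :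
    HasDerivAt (screlu α P) (clippedExp α x + clippedExp α (P - x) - 1) x := by
  have h1 := hasDerivAt_screluTail hα x
  have h2 : HasDerivAt (fun y => screluTail α (P - y)) (-(clippedExp α (P - x) - 1)) x := by
    have := (hasDerivAt_screluTail hα (P - x)).comp x ((hasDerivAt_id x).const_sub P)
    simpa using! this
  have h3 := ((hasDerivAt_id x).add h1).sub h2
  rw [show screlu α P = _ from funext (screlu_eq hP α)]
  convert! h3 using 1
  ring

lemma deriv_screlu {α P : ℝ} (hα : 0 < α) (hP : 0 < P) (x : ℝ) :
    deriv (screlu α P) x = clippedExp α x + clippedExp α (P - x) - 1 :=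
  (hasDerivAt_screlu hα hP x).deriv

lemma deriv_screlu_le_one {α P : ℝ} (hα : 0 < α) (hP : 0 < P) (x : ℝ) :
    deriv (screlu α P) x ≤ 1 := by
  rw [deriv_screlu hα hP]
  linarith [clippedExp_le_one hα x, clippedExp_le_one hα (P - x)]

lemma exp_neg_abs_le_deriv_screlu {α P : ℝ} (hα : 0 < α) (hP : 0 < P) (x : ℝ) :
    Real.exp (-|x| / α) ≤ deriv (screlu α P) x := by
  rw [deriv_screlu hα hP]
  rcases le_total 0 x with hx | hx
  · rw [clippedExp_of_nonneg hx, add_sub_cancel_left, clippedExp, abs_of_nonneg hx]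
    gcongr
    exact le_min (by linarith) (by linarith)
  · rw [clippedExp_of_nonneg (by linarith : 0 ≤ P - x), add_sub_cancel_right, clippedExp,
      abs_of_nonpos hx, min_eq_left hx, neg_neg]

lemma c11At_screlu {α P : ℝ} (hα : 0 < α) (hP : 0 < P) (x : ℝ) : C11At (screlu α P) x := by
  refine c11At_of_lipschitzWith_deriv (K := (2 / α).toNNReal)
    (fun y => (hasDerivAt_screlu hα hP y).differentiableAt)
    (LipschitzWith.of_dist_le_mul fun s t => ?_) x
  rw [Real.coe_toNNReal _ (by positivity), deriv_screlu hα hP, deriv_screlu hα hP,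
    Real.dist_eq, Real.dist_eq]
  have h1 := abs_clippedExp_sub_le hα s t
  have h2 := abs_clippedExp_sub_le hα (P - s) (P - t)
  rw [sub_sub_sub_cancel_left, abs_sub_comm t s] at h2
  calc _ = |(clippedExp α s - clippedExp α t)
        + (clippedExp α (P - s) - clippedExp α (P - t))| := by ring_nf
    _ ≤ _ := abs_add_le _ _
    _ ≤ 1 / α * |s - t| + 1 / α * |s - t| := add_le_add h1 h2
    _ = _ := by ring

end Screlu

namespace IsActivation

variable {γ β : ℝ} {a : ℝ → ℝ}

lemma c11At (ha : IsActivation γ β a) (x : ℝ) : C11At a x := by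
  refine c11At_of_lipschitzWith_deriv (K := β.toNNReal) ha.differentiable
    (LipschitzWith.of_dist_le_mul fun s t => ?_) x
  rw [Real.coe_toNNReal _ ha.beta_pos.le]
  exact ha.deriv_lipschitz s t

lemma abs_sub_le (ha : IsActivation γ β a) (x y : ℝ) : |a x - a y| ≤ |x - y| := by
  have h := convex_univ.norm_image_sub_le_of_norm_deriv_le (f := a) (C := 1) (x := y) (y := x)
    (fun z _ => ha.differentiable z) (fun z _ => ?_) (Set.mem_univ _) (Set.mem_univ _)
  · simpa using h
  · have h1 := ha.deriv_mem z
    rw [Real.norm_of_nonneg (ha.gamma_mem.1.le.trans h1.1)]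
    exact h1.2

end IsActivation

end WSR

namespace WSR

open Filter Topology
open scoped NNReal Matrix

/-! ### Weights and layers -/

section Network

variable {L N : ℕ} {n : ℕ → ℕ}

/-- The weight matrix of one layer as a linear function of all the weights. -/
noncomputable def weightLin (L : ℕ) (n : ℕ → ℕ) (l : ℕ) :
    Params L n →ₗ[ℝ] Matrix (Fin (n l)) (Fin (n (l + 1))) ℝ where
  toFun Θ := weight Θ l
  map_add' Θ Θ' := by
    ext i j
    by_cases h : l < L <;> simp [weight, h]
  map_smul' c Θ := by
    ext i j
    by_cases h : l < L <;> simp [weight, h]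

lemma weight_apply {l : ℕ} (hl : l < L) (Θ : Params L n) (i : Fin (n l)) (j : Fin (n (l + 1))) :
    weight Θ l i j = Θ ⟨⟨l, hl⟩, (i, j)⟩ := by
  simp [weight, hl]

lemma weight_add (Θ V : Params L n) (l : ℕ) : weight (Θ + V) l = weight Θ l + weight V l :=
  map_add (weightLin L n l) Θ V

lemma weight_sub (Θ V : Params L n) (l : ℕ) : weight (Θ - V) l = weight Θ l - weight V l :=
  map_sub (weightLin L n l) Θ V

lemma weight_smul (c : ℝ) (V : Params L n) (l : ℕ) : weight (c • V) l = c • weight V l :=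
  map_smul (weightLin L n l) c V

lemma contDiff_weight_apply (l : ℕ) (i : Fin (n l)) (j : Fin (n (l + 1))) :
    ContDiff ℝ 2 fun Θ : Params L n => weight Θ l i j := by
  by_cases h : l < L
  · simp only [weight_apply h]
    exact (EuclideanSpace.proj (𝕜 := ℝ) (⟨⟨l, h⟩, (i, j)⟩ :
      Σ l : Fin L, Fin (n l) × Fin (n (l + 1)))).contDiff
  · simp only [weight, h]
    exact contDiff_const

/-- The activation applied to the output of the weight with index `l`. -/
def layerAct (a b : ℝ → ℝ) (L l : ℕ) : ℝ → ℝ := if l + 1 = L then b else a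

lemma layer_succ (a b : ℝ → ℝ) (H : Matrix (Fin N) (Fin (n 0)) ℝ) (Θ : Params L n) (l : ℕ) :
    layer a b H Θ (l + 1) = (layer a b H Θ l * weight Θ l).map (layerAct a b L l) := rfl

lemma c11At_layer {a b : ℝ → ℝ} (ha : ∀ x, C11At a x) (hb : ∀ x, C11At b x)
    (H : Matrix (Fin N) (Fin (n 0)) ℝ) (Θ : Params L n) :
    ∀ l (r : Fin N) (k : Fin (n l)), C11At (fun Θ : Params L n => layer a b H Θ l r k) Θ
  | 0, r, k => c11At_const (H r k) Θ
  | l + 1, r, k => by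
    have hact : ∀ x, C11At (layerAct a b L l) x := by
      unfold layerAct; split_ifs <;> assumption
    have h : C11At (fun Θ : Params L n => (layer a b H Θ l * weight Θ l) r k) Θ := by
      simp only [Matrix.mul_apply]
      exact C11At.sum _ fun i _ => (c11At_layer ha hb H Θ l r i).mul
        (c11At_of_contDiffAt (contDiff_weight_apply l i k).contDiffAt)
    exact (hact _).comp h

/-! ### Forward and backward differentiation -/

/-- The derivatives of the activations at the pre-activations of one layer. -/
noncomputable def slope (a b : ℝ → ℝ) (H : Matrix (Fin N) (Fin (n 0)) ℝ) (Θ : Params L n) (l : ℕ) :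
    Matrix (Fin N) (Fin (n (l + 1))) ℝ :=
  (layer a b H Θ l * weight Θ l).map (deriv (layerAct a b L l))

/-- The derivative of the layer outputs at `Θ` in direction `V`, by forward differentiation. -/
noncomputable def tangent (a b : ℝ → ℝ) (H : Matrix (Fin N) (Fin (n 0)) ℝ) (Θ V : Params L n) :
    (l : ℕ) → Matrix (Fin N) (Fin (n l)) ℝ
  | 0 => 0
  | l + 1 => slope a b H Θ l ⊙ (tangent a b H Θ V l * weight Θ l + layer a b H Θ l * weight V l)

lemma hasDerivAt_layer {a b : ℝ → ℝ} (ha : Differentiable ℝ a) (hb : Differentiable ℝ b)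
    (H : Matrix (Fin N) (Fin (n 0)) ℝ) (Θ V : Params L n) :
    ∀ l (r : Fin N) (k : Fin (n l)),
      HasDerivAt (fun t : ℝ => layer a b H (Θ + t • V) l r k) (tangent a b H Θ V l r k) 0
  | 0, r, k => hasDerivAt_const 0 (H r k)
  | l + 1, r, k => by
    have hact : Differentiable ℝ (layerAct a b L l) := by
      unfold layerAct; split_ifs <;> assumption
    have h : HasDerivAt (fun t : ℝ => (layer a b H (Θ + t • V) l * weight (Θ + t • V) l) r k)
        ((tangent a b H Θ V l * weight Θ l + layer a b H Θ l * weight V l) r k) 0 := by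
      simp only [Matrix.mul_apply, Matrix.add_apply, ← Finset.sum_add_distrib]
      refine HasDerivAt.fun_sum fun i _ => ?_
      have h1 := hasDerivAt_layer ha hb H Θ V l r i
      have h2 : HasDerivAt (fun t : ℝ => weight (Θ + t • V) l i k) (weight V l i k) 0 := by
        simp only [weight_add, weight_smul, Matrix.add_apply, Matrix.smul_apply, smul_eq_mul]
        simpa using! ((hasDerivAt_id (0 : ℝ)).mul_const (weight V l i k)).const_add (weight Θ l i k)
      simpa using! h1.mul h2
    have h3 := (hact _).hasDerivAt.comp (0 : ℝ) h
    simpa [Function.comp_def, layer_succ, tangent, slope, Matrix.hadamard_apply] using! h3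

/-- The error at the output, propagated backwards to the output of layer `l` by the transposed
derivatives of the layers in between. -/
noncomputable def backprop (a b : ℝ → ℝ) (H : Matrix (Fin N) (Fin (n 0)) ℝ) (Θ : Params L n)
    (E : Matrix (Fin N) (Fin (n L)) ℝ) {l : ℕ} (hl : l ≤ L) : Matrix (Fin N) (Fin (n l)) ℝ :=
  Nat.decreasingInduction (motive := fun l _ => Matrix (Fin N) (Fin (n l)) ℝ)
    (fun l _ X => (slope a b H Θ l ⊙ X) * (weight Θ l)ᵀ) E hl

/-- The backpropagated error in front of the activations of one layer. -/
noncomputable def delta (a b : ℝ → ℝ) (H : Matrix (Fin N) (Fin (n 0)) ℝ) (Θ : Params L n)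
    (E : Matrix (Fin N) (Fin (n L)) ℝ) {l : ℕ} (hl : l < L) :
    Matrix (Fin N) (Fin (n (l + 1))) ℝ :=
  slope a b H Θ l ⊙ backprop a b H Θ E (Nat.succ_le_of_lt hl)

lemma backprop_self (a b : ℝ → ℝ) (H : Matrix (Fin N) (Fin (n 0)) ℝ) (Θ : Params L n)
    (E : Matrix (Fin N) (Fin (n L)) ℝ) : backprop a b H Θ E le_rfl = E :=
  Nat.decreasingInduction_self _ _

lemma backprop_of_lt (a b : ℝ → ℝ) (H : Matrix (Fin N) (Fin (n 0)) ℝ) (Θ : Params L n)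
    (E : Matrix (Fin N) (Fin (n L)) ℝ) {l : ℕ} (hl : l < L) :
    backprop a b H Θ E hl.le = delta a b H Θ E hl * (weight Θ l)ᵀ :=
  Nat.decreasingInduction_succ_left _ _ (Nat.succ_le_of_lt hl) hl.le

/-- The Frobenius inner product of real matrices. -/
def frobInner {p q : ℕ} (A B : Matrix (Fin p) (Fin q) ℝ) : ℝ := ∑ i, ∑ j, A i j * B i j

section frobInner

variable {p q s : ℕ}

lemma frobInner_eq_trace (A B : Matrix (Fin p) (Fin q) ℝ) : frobInner A B = (A * Bᵀ).trace := by
  simp [frobInner, Matrix.trace, Matrix.mul_apply]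

lemma frobInner_add_right (A B C : Matrix (Fin p) (Fin q) ℝ) :
    frobInner A (B + C) = frobInner A B + frobInner A C := by
  simp [frobInner, mul_add, Finset.sum_add_distrib]

lemma frobInner_zero_right (A : Matrix (Fin p) (Fin q) ℝ) : frobInner A 0 = 0 := by
  simp [frobInner]

lemma frobInner_hadamard_right (A S B : Matrix (Fin p) (Fin q) ℝ) :
    frobInner A (S ⊙ B) = frobInner (S ⊙ A) B := by
  simp only [frobInner, Matrix.hadamard_apply]
  exact Finset.sum_congr rfl fun i _ => Finset.sum_congr rfl fun j _ => by ring

lemma frobInner_mul_right (A : Matrix (Fin p) (Fin q) ℝ) (B : Matrix (Fin p) (Fin s) ℝ)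
    (W : Matrix (Fin s) (Fin q) ℝ) : frobInner A (B * W) = frobInner (A * Wᵀ) B := by
  rw [frobInner_eq_trace, frobInner_eq_trace, Matrix.transpose_mul, Matrix.mul_assoc]

lemma frobInner_mul_left (A : Matrix (Fin p) (Fin q) ℝ) (B : Matrix (Fin p) (Fin s) ℝ)
    (W : Matrix (Fin s) (Fin q) ℝ) : frobInner A (B * W) = frobInner (Bᵀ * A) W := by
  rw [frobInner_eq_trace, frobInner_eq_trace, Matrix.transpose_mul, ← Matrix.mul_assoc,
    Matrix.trace_mul_comm, Matrix.mul_assoc]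

end frobInner

lemma frobInner_backprop_tangent_succ (a b : ℝ → ℝ) (H : Matrix (Fin N) (Fin (n 0)) ℝ)
    (Θ V : Params L n) (E : Matrix (Fin N) (Fin (n L)) ℝ) {l : ℕ} (hl : l < L) :
    frobInner (backprop a b H Θ E (Nat.succ_le_of_lt hl)) (tangent a b H Θ V (l + 1)) =
      frobInner (backprop a b H Θ E hl.le) (tangent a b H Θ V l) +
        frobInner ((layer a b H Θ l)ᵀ * delta a b H Θ E hl) (weight V l) := by
  rw [tangent, frobInner_hadamard_right, frobInner_add_right, frobInner_mul_right,
    frobInner_mul_left, backprop_of_lt a b H Θ E hl]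
  rfl

lemma tangent_eq_zero (a b : ℝ → ℝ) (H : Matrix (Fin N) (Fin (n 0)) ℝ) (Θ V : Params L n) :
    ∀ {l : ℕ}, (∀ j < l, weight V j = 0) → tangent a b H Θ V l = 0
  | 0, _ => rfl
  | l + 1, h => by
    rw [tangent, tangent_eq_zero a b H Θ V fun j hj => h j (by omega), h l (by omega)]
    simp

/-- Backward differentiation is adjoint to forward differentiation; here for a direction that only
moves one weight matrix. -/
lemma frobInner_tangent (a b : ℝ → ℝ) (H : Matrix (Fin N) (Fin (n 0)) ℝ)
    (Θ V : Params L n) (E : Matrix (Fin N) (Fin (n L)) ℝ) {l : ℕ} (hl : l < L)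
    (hV : ∀ j, j ≠ l → weight V j = 0) :
    frobInner E (tangent a b H Θ V L) =
      frobInner ((layer a b H Θ l)ᵀ * delta a b H Θ E hl) (weight V l) := by
  have key : ∀ m, l + 1 ≤ m → ∀ hm : m ≤ L,
      frobInner (backprop a b H Θ E hm) (tangent a b H Θ V m) =
        frobInner ((layer a b H Θ l)ᵀ * delta a b H Θ E hl) (weight V l) := by
    intro m hlm
    induction m, hlm using Nat.le_induction with
    | base =>
      intro _
      rw [frobInner_backprop_tangent_succ a b H Θ V E hl,
        tangent_eq_zero a b H Θ V fun j hj => hV j hj.ne, frobInner_zero_right, zero_add]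
    | succ m hlm ih =>
      intro hm
      rw [frobInner_backprop_tangent_succ a b H Θ V E hm, ih (by omega), hV m (by omega),
        frobInner_zero_right, add_zero]
  have := key L hl le_rfl
  rwa [backprop_self] at this

/-! ### The gradient of the supervised loss -/

/-- The residual of the supervised problem. -/
def residual (a b : ℝ → ℝ) (H : Matrix (Fin N) (Fin (n 0)) ℝ) (pbar : Fin N → Fin (n L) → ℝ)
    (Θ : Params L n) : Matrix (Fin N) (Fin (n L)) ℝ :=
  layer a b H Θ L - Matrix.of pbar

variable {a : ℝ → ℝ} {α P : ℝ}

lemma c11At_output (ha : ∀ x, C11At a x) (hα : 0 < α) (hP : 0 < P)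
    (H : Matrix (Fin N) (Fin (n 0)) ℝ) (Θ : Params L n) (r : Fin N) (k : Fin (n L)) :
    C11At (fun Θ => output a α P H Θ r k) Θ :=
  c11At_layer ha (c11At_screlu hα hP) H Θ L r k

lemma c11At_lossSL (ha : ∀ x, C11At a x) (hα : 0 < α) (hP : 0 < P)
    (H : Matrix (Fin N) (Fin (n 0)) ℝ) (pbar : Fin N → Fin (n L) → ℝ) (Θ : Params L n) :
    C11At (lossSL a α P H pbar) Θ := by
  have h : ∀ r k, C11At (fun Θ => output a α P H Θ r k + -pbar r k) Θ := fun r k =>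
    (c11At_output ha hα hP H Θ r k).add (c11At_const _ _)
  refine (c11At_const _ _).mul (C11At.sum _ fun r _ => C11At.sum _ fun k _ => ?_)
  simp only [sq]
  exact (h r k).mul (h r k)

lemma lossSL_nonneg (H : Matrix (Fin N) (Fin (n 0)) ℝ) (pbar : Fin N → Fin (n L) → ℝ)
    (Θ : Params L n) : 0 ≤ lossSL a α P H pbar Θ := by
  unfold lossSL
  positivity

/-- The gradient with respect to one weight matrix, by backpropagation. -/
theorem weight_gradient_lossSL (ha : ∀ x, C11At a x) (hα : 0 < α) (hP : 0 < P)
    (H : Matrix (Fin N) (Fin (n 0)) ℝ) (pbar : Fin N → Fin (n L) → ℝ) (Θ : Params L n)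
    {l : ℕ} (hl : l < L) :
    weight (gradient (lossSL a α P H pbar) Θ) l = (layer a (screlu α P) H Θ l)ᵀ *
      delta a (screlu α P) H Θ (residual a (screlu α P) H pbar Θ) hl := by
  have hdir : ∀ V, inner ℝ (gradient (lossSL a α P H pbar) Θ) V =
      frobInner (residual a (screlu α P) H pbar Θ) (tangent a (screlu α P) H Θ V L) := by
    intro V
    rw [inner_gradient_left]
    have h1 : HasDerivAt (fun t : ℝ => lossSL a α P H pbar (Θ + t • V))
        (fderiv ℝ (lossSL a α P H pbar) Θ V) 0 := by
      have hline : HasDerivAt (fun t : ℝ => Θ + t • V) V 0 := by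
        simpa using! ((hasDerivAt_id (0 : ℝ)).smul_const V).const_add Θ
      have hf : HasFDerivAt (lossSL a α P H pbar) (fderiv ℝ (lossSL a α P H pbar) Θ)
          (Θ + (0 : ℝ) • V) := by
        simpa using (c11At_lossSL ha hα hP H pbar Θ).differentiableAt.hasFDerivAt
      exact hf.comp_hasDerivAt (0 : ℝ) hline
    have h2 : HasDerivAt (fun t : ℝ => lossSL a α P H pbar (Θ + t • V))
        (frobInner (residual a (screlu α P) H pbar Θ) (tangent a (screlu α P) H Θ V L)) 0 := by
      have hlay := hasDerivAt_layer (fun x => (ha x).differentiableAt)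
        (fun x => (c11At_screlu hα hP x).differentiableAt) H Θ V L
      have h3 := (HasDerivAt.fun_sum fun r (_ : r ∈ Finset.univ) =>
        HasDerivAt.fun_sum fun k (_ : k ∈ Finset.univ) =>
          ((hlay r k).sub_const (pbar r k)).pow 2).const_mul (1 / 2 : ℝ)
      refine h3.congr_deriv ?_
      simp only [frobInner, residual, Finset.mul_sum, Matrix.sub_apply, Matrix.of_apply,
        zero_smul, add_zero]
      refine Finset.sum_congr rfl fun r _ => Finset.sum_congr rfl fun k _ => ?_
      simp
      ring
    exact h1.unique h2
  ext i j
  set V : Params L n := EuclideanSpace.single ⟨⟨l, hl⟩, (i, j)⟩ 1 with hVdef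
  have hV : ∀ m, m ≠ l → weight V m = 0 := by
    intro m hm
    ext i' j'
    by_cases hmL : m < L
    · rw [weight_apply hmL, hVdef, PiLp.single_apply, if_neg]
      · rfl
      · intro h
        simp only [Sigma.mk.injEq, Fin.mk.injEq] at h
        exact hm h.1
    · simp [weight, hmL]
  have h1 := hdir V
  rw [frobInner_tangent _ _ H Θ V _ hl hV, frobInner, Finset.sum_eq_single i,
    Finset.sum_eq_single j] at h1
  · rw [weight_apply hl] at h1 ⊢
    rw [hVdef, EuclideanSpace.inner_single_right] at h1
    simpa using h1
  · intro j' _ hj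
    simp [weight_apply hl, hVdef, hj]
  · simp
  · intro i' _ hi
    refine Finset.sum_eq_zero fun j' _ => ?_
    simp [weight_apply hl, hVdef, hi]
  · simp

end Network

end WSR

namespace WSR

open Filter Topology

/-! ### Linear convergence of gradient descent in a region -/

section LinearConvergence

variable {E ι : Type*} [NormedAddCommGroup E] [InnerProductSpace ℝ E] [CompleteSpace E]

/-- Gradient descent on a nonnegative function that satisfies the Polyak–Łojasiewicz inequality with
constant `μ` on a region around the starting point. The region is a product of balls with radii
`d i` for seminorms `p i`. It is not left because the `i`-th component of the gradient is at most
`c i * √(2 f)`, which decays geometrically, so that the total displacement stays below `d i`. -/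
theorem exists_gradient_descent_linear_convergence (p : ι → Seminorm ℝ E) (c d : ι → ℝ)
    {f : E → ℝ} {x₀ : E} {μ : ℝ} (hμ : 0 < μ) {S : Set E}
    (hS : S = {x | ∀ i, p i (x - x₀) ≤ d i}) (hcomp : IsCompact S)
    (hf : ∀ x, C11At f x) (hnonneg : ∀ x, 0 ≤ f x)
    (hPL : ∀ x ∈ S, 2 * μ * f x ≤ ‖gradient f x‖ ^ 2)
    (hc : ∀ i, 0 ≤ c i) (hd : ∀ i, 0 ≤ d i)
    (hp : ∀ x ∈ S, ∀ i, p i (gradient f x) ≤ c i * √(2 * f x))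
    (hcd : ∀ i, 2 * (c i * √(2 * f x₀)) ≤ μ * d i) :
    ∃ ηbar : ℝ, 0 < ηbar ∧ ∀ η : ℝ, 0 < η → η < ηbar → η * μ < 1 ∧
      ∀ x : ℕ → E, x 0 = x₀ → (∀ m, x (m + 1) = x m - η • gradient f (x m)) →
        (∃ xs, Tendsto x atTop (𝓝 xs) ∧ f xs = 0) ∧
          ∀ m, f (x m) ≤ (1 - η * μ) ^ m * f x₀ := by
  obtain ⟨η₁, hη₁, hdec⟩ := exists_gradient_step_decrease hcomp fun x _ => hf x
  refine ⟨min η₁ (1 / μ), by positivity, fun η hη hlt => ?_⟩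
  have hημ : η * μ < 1 := (lt_div_iff₀ hμ).1 (hlt.trans_le (min_le_right _ _))
  refine ⟨hημ, fun x hx0 hx => ?_⟩
  have hdec' := hdec η hη (hlt.trans_le (min_le_left _ _))
  set q := 1 - η * μ with hq
  have hq0 : 0 < q := by linarith
  have hq1 : q < 1 := by have := mul_pos hη hμ; linarith
  set s := √q with hs
  have hs0 : 0 ≤ s := Real.sqrt_nonneg q
  have hsq : s ^ 2 = q := Real.sq_sqrt hq0.le
  have hs1 : s < 1 := by nlinarith
  have hsqrt : ∀ m, √(2 * (q ^ m * f x₀)) = √(2 * f x₀) * s ^ m := fun m => by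
    rw [show 2 * (q ^ m * f x₀) = 2 * f x₀ * (s ^ m) ^ 2 by rw [← hsq]; ring,
      Real.sqrt_mul (by have := hnonneg x₀; positivity), Real.sqrt_sq (by positivity)]
  have hmem : ∀ m, (∀ i, p i (x m - x₀) ≤ d i * (1 - s ^ m)) → x m ∈ S := fun m h => by
    rw [hS]
    intro i
    refine (h i).trans (mul_le_of_le_one_right (hd i) ?_)
    have : 0 ≤ s ^ m := by positivity
    linarith
  have key : ∀ m, f (x m) ≤ q ^ m * f x₀ ∧ ∀ i, p i (x m - x₀) ≤ d i * (1 - s ^ m) := by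
    intro m
    induction m with
    | zero => simp [hx0]
    | succ m ih =>
      obtain ⟨ih1, ih2⟩ := ih
      have hxS := hmem m ih2
      constructor
      · rw [hx m]
        calc f (x m - η • gradient f (x m)) ≤ f (x m) - η / 2 * ‖gradient f (x m)‖ ^ 2 :=
              hdec' _ hxS
          _ ≤ f (x m) - η / 2 * (2 * μ * f (x m)) := by gcongr; exact hPL _ hxS
          _ = q * f (x m) := by rw [hq]; ring
          _ ≤ q * (q ^ m * f x₀) := by gcongr
          _ = q ^ (m + 1) * f x₀ := by ring
      · intro i
        have h1 : p i (x (m + 1) - x₀) ≤ p i (x m - x₀) + η * p i (gradient f (x m)) := by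
          rw [hx m, sub_right_comm]
          refine (map_sub_le_add (p i) _ _).trans ?_
          rw [map_smul_eq_mul, Real.norm_of_nonneg hη.le]
        have h2 : p i (gradient f (x m)) ≤ c i * (√(2 * f x₀) * s ^ m) := by
          rw [← hsqrt]
          refine (hp _ hxS i).trans ?_
          have := hc i
          gcongr
        -- `1 - s` is at least `η μ / 2`, since `(1 - s) (1 + s) = η μ`
        have h3 : η * μ ≤ 2 * (1 - s) := by nlinarith
        have h4 : η * (c i * (√(2 * f x₀) * s ^ m)) ≤ d i * (s ^ m - s ^ (m + 1)) := by
          have hsm : 0 ≤ s ^ m := by positivity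
          have h5 : η * (2 * (c i * √(2 * f x₀))) ≤ 2 * (1 - s) * d i :=
            calc η * (2 * (c i * √(2 * f x₀))) ≤ η * (μ * d i) := mul_le_mul_of_nonneg_left (hcd i) hη.le
              _ = η * μ * d i := by ring
              _ ≤ _ := by gcongr; exact hd i
          have h6 := mul_le_mul_of_nonneg_right h5 hsm
          rw [pow_succ]
          linarith
        have h7 := mul_le_mul_of_nonneg_left h2 hη.le
        have := ih2 i
        linarith
  refine ⟨?_, fun m => (key m).1⟩
  have hstep : ∀ m, dist (x m) (x (m + 1)) ≤ √(η * (2 * f x₀)) * s ^ m := by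
    intro m
    -- the decrease in one step bounds the gradient, since `f` stays nonnegative
    have h1 := hdec' _ (hmem m (key m).2)
    have h2 := hnonneg (x m - η • gradient f (x m))
    have h3 := (key m).1
    have hf0 := hnonneg x₀
    rw [hx m, dist_eq_norm, sub_sub_cancel, norm_smul, Real.norm_of_nonneg hη.le]
    refine le_of_sq_le_sq ?_ (by positivity)
    rw [mul_pow, mul_pow, Real.sq_sqrt (by positivity), ← pow_mul, mul_comm m, pow_mul, hsq]
    have h4 : η / 2 * ‖gradient f (x m)‖ ^ 2 ≤ q ^ m * f x₀ := by linarith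
    nlinarith [mul_le_mul_of_nonneg_left h4 hη.le]
  obtain ⟨xs, hxs⟩ := cauchySeq_tendsto_of_complete (cauchySeq_of_le_geometric s _ hs1 hstep)
  refine ⟨xs, hxs, le_antisymm ?_ (hnonneg xs)⟩
  have h1 : Tendsto (fun m => f (x m)) atTop (𝓝 (f xs)) :=
    (hf xs).contDiffAt.continuousAt.tendsto.comp hxs
  have h2 : Tendsto (fun m => q ^ m * f x₀) atTop (𝓝 (0 * f x₀)) :=
    (tendsto_pow_atTop_nhds_zero_of_lt_one hq0.le hq1).mul_const _
  rw [zero_mul] at h2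
  exact le_of_tendsto_of_tendsto' h1 h2 fun m => (key m).1

/-- Gradient descent that stays in a compact set drives the gradient to zero. -/
theorem exists_tendsto_gradient_zero {f : E → ℝ} {C : Set E} (hC : IsCompact C)
    (hf : ∀ x ∈ C, C11At f x) :
    ∃ ηbar : ℝ, 0 < ηbar ∧ ∀ η : ℝ, 0 < η → η < ηbar →
      ∀ x : ℕ → E, (∀ m, x m ∈ C) → (∀ m, x (m + 1) = x m - η • gradient f (x m)) →
        Tendsto (fun m => gradient f (x m)) atTop (𝓝 0) := by
  obtain ⟨ηbar, hηbar, hdec⟩ := exists_gradient_step_decrease hC hf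
  refine ⟨ηbar, hηbar, fun η hη hlt x hxC hx => ?_⟩
  obtain ⟨b, hb⟩ := hC.bddBelow_image (f := f) fun x hx =>
    (hf x hx).contDiffAt.continuousAt.continuousWithinAt
  have hstep : ∀ m, η / 2 * ‖gradient f (x m)‖ ^ 2 ≤ f (x m) - f (x (m + 1)) := fun m => by
    have := hdec η hη hlt _ (hxC m)
    rw [← hx m] at this
    linarith
  have hsum : Summable fun m => η / 2 * ‖gradient f (x m)‖ ^ 2 := by
    refine summable_of_sum_range_le (c := f (x 0) - b) (fun m => by positivity) fun m => ?_
    calc _ ≤ ∑ i ∈ Finset.range m, (f (x i) - f (x (i + 1))) :=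
          Finset.sum_le_sum fun i _ => hstep i
      _ = f (x 0) - f (x m) := Finset.sum_range_sub' _ _
      _ ≤ _ := sub_le_sub_left (hb ⟨x m, hxC m, rfl⟩) _
  have h0 := (hsum.tendsto_atTop_zero.const_mul (2 / η)).sqrt
  rw [tendsto_zero_iff_norm_tendsto_zero]
  simpa [← mul_assoc, div_mul_div_cancel₀, hη.ne', Real.sqrt_sq] using h0

end LinearConvergence

end WSR

namespace WSR

open scoped Matrix Matrix.Norms.Frobenius

/-! ### Bounds on the layers and on the backpropagated errors -/

section MatrixBounds

variable {p q : ℕ}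

lemma frobenius_norm_le_of_abs_le {A B : Matrix (Fin p) (Fin q) ℝ} (h : ∀ i j, |A i j| ≤ |B i j|) :
    ‖A‖ ≤ ‖B‖ := by
  refine le_of_sq_le_sq ?_ (norm_nonneg _)
  rw [frobenius_norm_sq, frobenius_norm_sq]
  exact Finset.sum_le_sum fun i _ => Finset.sum_le_sum fun j _ => sq_le_sq.2 (h i j)

lemma abs_entry_le_frobenius_norm (A : Matrix (Fin p) (Fin q) ℝ) (i : Fin p) (j : Fin q) :
    |A i j| ≤ ‖A‖ := by
  refine abs_le_of_sq_le_sq ?_ (norm_nonneg _)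
  rw [frobenius_norm_sq]
  exact (Finset.single_le_sum (f := fun j => A i j ^ 2) (fun _ _ => sq_nonneg _)
    (Finset.mem_univ j)).trans (Finset.single_le_sum (f := fun i => ∑ j, A i j ^ 2)
      (fun _ _ => Finset.sum_nonneg fun _ _ => sq_nonneg _) (Finset.mem_univ i))

lemma norm_hadamard_le {S : Matrix (Fin p) (Fin q) ℝ} (hS : ∀ i j, |S i j| ≤ 1)
    (X : Matrix (Fin p) (Fin q) ℝ) : ‖S ⊙ X‖ ≤ ‖X‖ :=
  frobenius_norm_le_of_abs_le fun i j => by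
    rw [Matrix.hadamard_apply, abs_mul]
    exact mul_le_of_le_one_left (abs_nonneg _) (hS i j)

lemma mul_norm_le_norm_hadamard {c : ℝ} (hc : 0 ≤ c) {S : Matrix (Fin p) (Fin q) ℝ}
    (hS : ∀ i j, c ≤ S i j) (X : Matrix (Fin p) (Fin q) ℝ) : c * ‖X‖ ≤ ‖S ⊙ X‖ := by
  calc c * ‖X‖ = ‖c • X‖ := by rw [norm_smul, Real.norm_of_nonneg hc]
    _ ≤ _ := frobenius_norm_le_of_abs_le fun i j => by
      rw [Matrix.hadamard_apply, Matrix.smul_apply, smul_eq_mul, abs_mul, abs_mul, abs_of_nonneg hc,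
        abs_of_nonneg (hc.trans (hS i j))]
      exact mul_le_mul_of_nonneg_right (hS i j) (abs_nonneg _)

variable {m : ℕ} {d : ℝ} {A A₀ : Matrix (Fin p) (Fin q) ℝ}

lemma norm_mul_le_of_near (h : ‖A - A₀‖ ≤ d) (X : Matrix (Fin m) (Fin p) ℝ) :
    ‖X * A‖ ≤ (sigmaMax A₀ + d) * ‖X‖ := by
  calc ‖X * A‖ = ‖X * A₀ + X * (A - A₀)‖ := by rw [← Matrix.mul_add, add_sub_cancel]
    _ ≤ ‖X * A₀‖ + ‖X * (A - A₀)‖ := norm_add_le _ _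
    _ ≤ sigmaMax A₀ * ‖X‖ + ‖X‖ * d := add_le_add (norm_mul_le_sigmaMax X A₀)
        ((Matrix.frobenius_norm_mul _ _).trans (by gcongr))
    _ = _ := by ring

lemma norm_mul_transpose_le_of_near (h : ‖A - A₀‖ ≤ d) (X : Matrix (Fin m) (Fin q) ℝ) :
    ‖X * Aᵀ‖ ≤ (sigmaMax A₀ + d) * ‖X‖ := by
  calc ‖X * Aᵀ‖ = ‖X * A₀ᵀ + X * (A - A₀)ᵀ‖ := by
        rw [← Matrix.mul_add, ← Matrix.transpose_add, add_sub_cancel]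
    _ ≤ ‖X * A₀ᵀ‖ + ‖X * (A - A₀)ᵀ‖ := norm_add_le _ _
    _ ≤ sigmaMax A₀ * ‖X‖ + ‖X‖ * d := add_le_add (norm_mul_transpose_le_sigmaMax X A₀)
        ((Matrix.frobenius_norm_mul _ _).trans
          (by rw [Matrix.frobenius_norm_transpose]; gcongr))
    _ = _ := by ring

lemma le_norm_mul_transpose_of_near (hqp : q ≤ p) (h : ‖A - A₀‖ ≤ d)
    (X : Matrix (Fin m) (Fin q) ℝ) : (sigmaMin A₀ - d) * ‖X‖ ≤ ‖X * Aᵀ‖ := by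
  have h1 := sigmaMin_mul_norm_le_norm_mul_transpose hqp X A₀
  have h2 : ‖X * (A - A₀)ᵀ‖ ≤ ‖X‖ * d := (Matrix.frobenius_norm_mul _ _).trans
    (by rw [Matrix.frobenius_norm_transpose]; gcongr)
  have h3 : X * A₀ᵀ = X * Aᵀ - X * (A - A₀)ᵀ := by
    rw [← Matrix.mul_sub, ← Matrix.transpose_sub, sub_sub_cancel]
  have h4 := norm_sub_le (X * Aᵀ) (X * (A - A₀)ᵀ)
  rw [← h3] at h4
  linarith

lemma le_norm_transpose_mul_of_near (hp : 0 < p) (hpq : p ≤ q) (h : ‖A - A₀‖ ≤ d)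
    (X : Matrix (Fin p) (Fin m) ℝ) : (sigmaMin A₀ - d) * ‖X‖ ≤ ‖Aᵀ * X‖ := by
  have h1 := sigmaMin_mul_norm_le_norm_transpose_mul hp hpq A₀ X
  have h2 : ‖(A - A₀)ᵀ * X‖ ≤ d * ‖X‖ := (Matrix.frobenius_norm_mul _ _).trans
    (by rw [Matrix.frobenius_norm_transpose]; gcongr)
  have h3 : A₀ᵀ * X = Aᵀ * X - (A - A₀)ᵀ * X := by
    rw [← Matrix.sub_mul, ← Matrix.transpose_sub, sub_sub_cancel]
  have h4 := norm_sub_le (Aᵀ * X) ((A - A₀)ᵀ * X)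
  rw [← h3] at h4
  linarith

end MatrixBounds

section NetworkBounds

variable {L N : ℕ} {n : ℕ → ℕ} {γ β α P : ℝ} {a : ℝ → ℝ} {H : Matrix (Fin N) (Fin (n 0)) ℝ}
  {Θ : Params L n} {s : ℕ → ℝ}

lemma norm_layer_le (ha : IsActivation γ β a) (b : ℝ → ℝ) (hs0 : ∀ l < L, 0 ≤ s l)
    (hs : ∀ l < L, ∀ X : Matrix (Fin N) (Fin (n l)) ℝ, ‖X * weight Θ l‖ ≤ s l * ‖X‖) :
    ∀ l < L, ‖layer a b H Θ l‖ ≤ ‖H‖ * ∏ j ∈ Finset.range l, s j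
  | 0, _ => by simp [layer]
  | l + 1, hl => by
    have ih := norm_layer_le ha b hs0 hs l (by omega)
    rw [layer_succ, layerAct, if_neg hl.ne, Finset.prod_range_succ]
    calc _ ≤ ‖layer a b H Θ l * weight Θ l‖ :=
          frobenius_norm_le_of_abs_le fun i j => ha.abs_le _
      _ ≤ s l * ‖layer a b H Θ l‖ := hs l (by omega) _
      _ ≤ s l * (‖H‖ * ∏ j ∈ Finset.range l, s j) :=
          mul_le_mul_of_nonneg_left ih (hs0 l (by omega))
      _ = _ := by ring

lemma abs_slope_le_one (ha : IsActivation γ β a) (hα : 0 < α) (hP : 0 < P) (l : ℕ) (i : Fin N)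
    (j : Fin (n (l + 1))) : |slope a (screlu α P) H Θ l i j| ≤ 1 := by
  rw [slope, Matrix.map_apply, layerAct]
  split_ifs
  · rw [abs_of_nonneg ((Real.exp_nonneg _).trans (exp_neg_abs_le_deriv_screlu hα hP _))]
    exact deriv_screlu_le_one hα hP _
  · rw [abs_of_nonneg (ha.gamma_mem.1.le.trans (ha.deriv_mem _).1)]
    exact (ha.deriv_mem _).2

lemma gamma_le_slope (ha : IsActivation γ β a) {b : ℝ → ℝ} {l : ℕ} (hl : l + 1 < L) (i : Fin N)
    (j : Fin (n (l + 1))) : γ ≤ slope a b H Θ l i j := by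
  rw [slope, Matrix.map_apply, layerAct, if_neg hl.ne]
  exact (ha.deriv_mem _).1

/-- The pre-activations of the output layer are bounded by the product of all the expansion factors,
which keeps the SCReLU away from its flat parts. -/
lemma exp_le_slope_last (ha : IsActivation γ β a) (hα : 0 < α) (hP : 0 < P)
    (hs0 : ∀ l < L, 0 ≤ s l)
    (hs : ∀ l < L, ∀ X : Matrix (Fin N) (Fin (n l)) ℝ, ‖X * weight Θ l‖ ≤ s l * ‖X‖)
    {l : ℕ} (hl : l + 1 = L) (i : Fin N) (j : Fin (n (l + 1))) :
    Real.exp (-(‖H‖ * ∏ j ∈ Finset.range L, s j) / α) ≤ slope a (screlu α P) H Θ l i j := by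
  rw [slope, Matrix.map_apply, layerAct, if_pos hl]
  refine le_trans ?_ (exp_neg_abs_le_deriv_screlu hα hP _)
  have h1 : |(layer a (screlu α P) H Θ l * weight Θ l) i j| ≤ ‖H‖ * ∏ j ∈ Finset.range L, s j := by
    calc _ ≤ ‖layer a (screlu α P) H Θ l * weight Θ l‖ := abs_entry_le_frobenius_norm _ _ _
      _ ≤ s l * ‖layer a (screlu α P) H Θ l‖ := hs l (by omega) _
      _ ≤ s l * (‖H‖ * ∏ j ∈ Finset.range l, s j) :=
          mul_le_mul_of_nonneg_left (norm_layer_le ha _ hs0 hs l (by omega)) (hs0 l (by omega))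
      _ = _ := by rw [← hl, Finset.prod_range_succ]; ring
  gcongr

lemma norm_backprop_le (ha : IsActivation γ β a) (hα : 0 < α) (hP : 0 < P)
    (hs0 : ∀ l < L, 0 ≤ s l)
    (hs : ∀ l < L, ∀ X : Matrix (Fin N) (Fin (n (l + 1))) ℝ, ‖X * (weight Θ l)ᵀ‖ ≤ s l * ‖X‖)
    (E : Matrix (Fin N) (Fin (n L)) ℝ) {l : ℕ} (hl : l ≤ L) :
    ‖backprop a (screlu α P) H Θ E hl‖ ≤ (∏ j ∈ Finset.Ico l L, s j) * ‖E‖ := by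
  induction hl using Nat.decreasingInduction with
  | self => rw [backprop_self]; simp
  | of_succ l hl ih =>
    rw [backprop_of_lt _ _ _ _ _ hl, ← Finset.mul_prod_Ioo_eq_prod_Ico hl,
      ← Finset.Ico_succ_left_eq_Ioo, mul_assoc]
    refine (hs l hl _).trans (mul_le_mul_of_nonneg_left ?_ (hs0 l hl))
    exact (norm_hadamard_le (abs_slope_le_one ha hα hP l) _).trans ih

lemma norm_delta_le (ha : IsActivation γ β a) (hα : 0 < α) (hP : 0 < P)
    (hs0 : ∀ l < L, 0 ≤ s l)
    (hs : ∀ l < L, ∀ X : Matrix (Fin N) (Fin (n (l + 1))) ℝ, ‖X * (weight Θ l)ᵀ‖ ≤ s l * ‖X‖)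
    (E : Matrix (Fin N) (Fin (n L)) ℝ) {l : ℕ} (hl : l < L) :
    ‖delta a (screlu α P) H Θ E hl‖ ≤ (∏ j ∈ Finset.Ico (l + 1) L, s j) * ‖E‖ :=
  (norm_hadamard_le (abs_slope_le_one ha hα hP l) _).trans
    (norm_backprop_le ha hα hP hs0 hs E hl)

lemma le_norm_delta (ha : IsActivation γ β a) {t : ℕ → ℝ} {κ : ℝ} (hκ : 0 ≤ κ)
    (hlast : ∀ l, l + 1 = L → ∀ i j, κ ≤ slope a (screlu α P) H Θ l i j)
    (ht : ∀ l, 2 ≤ l → l < L → ∀ X : Matrix (Fin N) (Fin (n (l + 1))) ℝ,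
      t l * ‖X‖ ≤ ‖X * (weight Θ l)ᵀ‖)
    (ht0 : ∀ l, 2 ≤ l → l < L → 0 ≤ t l)
    (E : Matrix (Fin N) (Fin (n L)) ℝ) (d : ℕ) :
    ∀ l, 1 ≤ l → l + d + 1 = L → ∀ hl : l < L,
      κ * γ ^ d * (∏ j ∈ Finset.Ico (l + 1) L, t j) * ‖E‖ ≤
        ‖delta a (screlu α P) H Θ E hl‖ := by
  induction d with
  | zero =>
    intro l _ hlL hl
    obtain rfl : l + 1 = L := hlL
    rw [delta, backprop_self]
    simpa using mul_norm_le_norm_hadamard hκ (hlast l rfl) E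
  | succ d ih =>
    intro l h1 hlL hl
    have hl' : l + 1 < L := by omega
    have hγ := ha.gamma_mem.1.le
    rw [delta, backprop_of_lt _ _ _ _ _ hl', ← Finset.mul_prod_Ioo_eq_prod_Ico hl',
      ← Finset.Ico_succ_left_eq_Ioo]
    calc _ = γ * (t (l + 1) *
          (κ * γ ^ d * (∏ j ∈ Finset.Ico (Order.succ (l + 1)) L, t j) * ‖E‖)) := by ring
      _ ≤ γ * (t (l + 1) * ‖delta a (screlu α P) H Θ E hl'‖) := by
          have := ht0 (l + 1) (by omega) hl'
          gcongr
          exact ih (l + 1) (by omega) (by omega) hl'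
      _ ≤ γ * ‖delta a (screlu α P) H Θ E hl' * (weight Θ (l + 1))ᵀ‖ := by
          gcongr
          exact ht (l + 1) (by omega) hl' _
      _ ≤ _ := mul_norm_le_norm_hadamard hγ (gamma_le_slope ha hl') _

lemma norm_residual (pbar : Fin N → Fin (n L) → ℝ) :
    ‖residual a (screlu α P) H pbar Θ‖ = √(2 * lossSL a α P H pbar Θ) := by
  rw [← Real.sqrt_sq (norm_nonneg (residual a (screlu α P) H pbar Θ)), frobenius_norm_sq]
  congr 1
  simp only [lossSL, residual, output, Matrix.sub_apply, Matrix.of_apply]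
  ring

lemma norm_weight_gradient_le (ha : IsActivation γ β a) (hα : 0 < α) (hP : 0 < P)
    (hs0 : ∀ l < L, 0 < s l)
    (hs : ∀ l < L, ∀ X : Matrix (Fin N) (Fin (n l)) ℝ, ‖X * weight Θ l‖ ≤ s l * ‖X‖)
    (hsT : ∀ l < L, ∀ X : Matrix (Fin N) (Fin (n (l + 1))) ℝ, ‖X * (weight Θ l)ᵀ‖ ≤ s l * ‖X‖)
    (pbar : Fin N → Fin (n L) → ℝ) {l : ℕ} (hl : l < L) :
    ‖weight (gradient (lossSL a α P H pbar) Θ) l‖ ≤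
      ‖H‖ * (∏ j ∈ Finset.range L, s j) / s l * √(2 * lossSL a α P H pbar Θ) := by
  rw [weight_gradient_lossSL ha.c11At hα hP H pbar Θ hl, ← norm_residual]
  refine (Matrix.frobenius_norm_mul _ _).trans ?_
  rw [Matrix.frobenius_norm_transpose]
  have hprod : (∏ j ∈ Finset.range L, s j) / s l =
      (∏ j ∈ Finset.range l, s j) * ∏ j ∈ Finset.Ico (l + 1) L, s j := by
    rw [← Finset.prod_range_mul_prod_Ico s (Nat.succ_le_of_lt hl), Finset.prod_range_succ]
    have := (hs0 l hl).ne'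
    field_simp
  have hs0' : ∀ l < L, 0 ≤ s l := fun l hl => (hs0 l hl).le
  have h0 : 0 ≤ ∏ j ∈ Finset.range l, s j :=
    Finset.prod_nonneg fun j hj => hs0' j ((Finset.mem_range.1 hj).trans hl)
  calc _ ≤ (‖H‖ * ∏ j ∈ Finset.range l, s j) * ((∏ j ∈ Finset.Ico (l + 1) L, s j) *
        ‖residual a (screlu α P) H pbar Θ‖) :=
        mul_le_mul (norm_layer_le ha _ hs0' hs l hl) (norm_delta_le ha hα hP hs0' hsT _ hl)
          (norm_nonneg _) (by positivity)
    _ = _ := by rw [mul_div_assoc, hprod]; ring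

lemma norm_sq_eq_sum_weight (V : Params L n) : ‖V‖ ^ 2 = ∑ l : Fin L, ‖weight V l‖ ^ 2 := by
  rw [EuclideanSpace.norm_sq_eq, Fintype.sum_sigma]
  refine Finset.sum_congr rfl fun l _ => ?_
  rw [frobenius_norm_sq, Fintype.sum_prod_type]
  simp [weight_apply l.2]

lemma norm_weight_le (V : Params L n) (l : Fin L) : ‖weight V l‖ ≤ ‖V‖ := by
  refine le_of_sq_le_sq ?_ (norm_nonneg _)
  rw [norm_sq_eq_sum_weight]
  exact Finset.single_le_sum (f := fun l : Fin L => ‖weight V l‖ ^ 2) (fun _ _ => sq_nonneg _)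
    (Finset.mem_univ l)

lemma continuous_weight (l : ℕ) : Continuous fun Θ : Params L n => weight Θ l :=
  continuous_matrix fun i j => (contDiff_weight_apply l i j).continuous

lemma isCompact_weight_near (Θ₀ : Params L n) (d : Fin L → ℝ) :
    IsCompact {Θ : Params L n | ∀ l : Fin L, ‖weight (Θ - Θ₀) l‖ ≤ d l} := by
  refine Metric.isCompact_of_isClosed_isBounded ?_ ?_
  · simp only [Set.ofPred_forall]
    exact isClosed_iInter fun l => isClosed_le
      ((continuous_weight l).comp (continuous_id.sub continuous_const)).norm continuous_const
  · refine (Metric.isBounded_closedBall (x := Θ₀) (r := √(∑ l, d l ^ 2))).subset fun Θ hΘ => ?_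
    rw [Metric.mem_closedBall, dist_eq_norm]
    refine Real.le_sqrt_of_sq_le ?_
    rw [norm_sq_eq_sum_weight]
    exact Finset.sum_le_sum fun l _ => by have := hΘ l; gcongr

lemma norm_layer_one_sub_le (ha : IsActivation γ β a) (b : ℝ → ℝ) (hL : 2 ≤ L)
    (Θ Θ₀ : Params L n) :
    ‖layer a b H Θ 1 - (H * weight Θ₀ 0).map a‖ ≤ sigmaMax H * ‖weight (Θ - Θ₀) 0‖ := by
  refine le_trans ?_ (norm_mul_le_sigmaMax_left H _)
  rw [layer_succ, layerAct, if_neg (by omega), weight_sub, Matrix.mul_sub]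
  exact frobenius_norm_le_of_abs_le fun i j => ha.abs_sub_le _ _

end NetworkBounds

end WSR

namespace WSR

open scoped Matrix Matrix.Norms.Frobenius

/-! ### The initialization constants -/

section Constants

variable {L N : ℕ} {n : ℕ → ℕ} {γ α f₀ : ℝ} {a : ℝ → ℝ} {H : Matrix (Fin N) (Fin (n 0)) ℝ}
  {Θ₀ : Params L n}

lemma lamBar_pos (hlam : ∀ l ∈ Finset.Icc 3 L, 0 < lamLow Θ₀ l) {l : ℕ} (hl : l ≤ L) :
    0 < lamBar Θ₀ l := by
  unfold lamBar
  split_ifs with h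
  · have := sigmaMax_nonneg (weight Θ₀ (l - 1))
    positivity
  · exact (hlam l (by simp; omega)).trans_le (sigmaMin_le_sigmaMax _)

lemma lamLowProd_pos (hlam : ∀ l ∈ Finset.Icc 3 L, 0 < lamLow Θ₀ l) : 0 < lamLowProd Θ₀ :=
  Finset.prod_pos hlam

lemma lamBarProd_pos (hlam : ∀ l ∈ Finset.Icc 3 L, 0 < lamLow Θ₀ l) : 0 < lamBarProd Θ₀ :=
  Finset.prod_pos fun _ hl => lamBar_pos hlam (Finset.mem_Icc.1 hl).2

lemma prod_lamBar (hL : 2 ≤ L) (Θ₀ : Params L n) :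
    ∏ l ∈ Finset.Icc 1 L, lamBar Θ₀ l = lamBar Θ₀ 1 * lamBar Θ₀ 2 * lamBarProd Θ₀ := by
  rw [← Finset.insert_Icc_succ_left_eq_Icc (by omega : 1 ≤ L), Finset.prod_insert (by simp),
    Order.succ_eq_add_one, ← Finset.insert_Icc_succ_left_eq_Icc (by omega : 1 + 1 ≤ L),
    Finset.prod_insert (by simp), mul_assoc]
  rfl

lemma alphaH_eq (hL : 2 ≤ L) (H : Matrix (Fin N) (Fin (n 0)) ℝ) (Θ₀ : Params L n) :
    alphaH H Θ₀ =
      (3 / 2) ^ L * (‖H‖ * (lamBar Θ₀ 1 * lamBar Θ₀ 2 * lamBarProd Θ₀)) := by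
  rw [alphaH, prod_lamBar hL, frobNorm_eq_norm]

lemma alphaH_eq_prod (H : Matrix (Fin N) (Fin (n 0)) ℝ) (Θ₀ : Params L n) :
    alphaH H Θ₀ = ‖H‖ * ∏ j ∈ Finset.range L, 3 / 2 * lamBar Θ₀ (j + 1) := by
  rw [alphaH, frobNorm_eq_norm, Finset.prod_mul_distrib, Finset.prod_const, Finset.card_range,
    Finset.range_eq_Ico, Finset.prod_Ico_add' (fun j => lamBar Θ₀ j) 0 L 1, zero_add,
    Finset.Ico_add_one_right_eq_Icc]
  ring

lemma prod_Ico_lamLow (Θ₀ : Params L n) :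
    ∏ j ∈ Finset.Ico 2 L, lamLow Θ₀ (j + 1) / 2 = lamLowProd Θ₀ * (1 / 2) ^ (L - 2) := by
  simp only [div_eq_mul_one_div (lamLow Θ₀ _) (2 : ℝ)]
  rw [Finset.prod_mul_distrib, Finset.prod_const, Nat.card_Ico,
    Finset.prod_Ico_add' (fun j => lamLow Θ₀ j) 2 L 1, Finset.Ico_add_one_right_eq_Icc]
  rfl

/-- The constant of the Polyak–Łojasiewicz inequality without its factor `lamH ^ 2`: a quarter of the
lower bound for the squared norm of the backpropagated error in front of the second activation,
relative to that of the residual. The quarter accounts for the first hidden layer, whose smallest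
singular value is only known to stay above `lamH / 2`. -/
noncomputable def backpropRate (γ α : ℝ) (H : Matrix (Fin N) (Fin (n 0)) ℝ) (Θ₀ : Params L n) : ℝ :=
  Real.exp (-(2 * alphaH H Θ₀ / α)) * γ ^ (2 * (L - 2)) * (1 / 2) ^ (2 * (L - 1)) *
    lamLowProd Θ₀ ^ 2

lemma backpropRate_pos (hγ : 0 < γ) (hlam : ∀ l ∈ Finset.Icc 3 L, 0 < lamLow Θ₀ l) :
    0 < backpropRate γ α H Θ₀ := by
  have := lamLowProd_pos hlam
  unfold backpropRate
  positivity

lemma depth_factor_eq (hL : 2 ≤ L) (hγ : 0 < γ) :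
    γ ^ 4 / 3 * (6 / γ ^ 2) ^ L * (γ ^ (2 * (L - 2)) * (1 / 2) ^ (2 * (L - 1))) =
      2 * (3 / 2 : ℝ) ^ (L - 1) := by
  obtain ⟨k, rfl⟩ := Nat.exists_eq_add_of_le' hL
  have h1 : (6 : ℝ) ^ (k + 1) * (1 / 4) ^ (k + 1) = (3 / 2) ^ (k + 1) := by
    rw [← mul_pow]; norm_num
  rw [show k + 2 - 2 = k by omega, show k + 2 - 1 = k + 1 by omega, ← h1, pow_mul (1 / 2 : ℝ),
    div_pow, ← pow_mul]
  norm_num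
  field_simp
  ring

lemma le_pow_of_rpow_le {x y e : ℝ} (hx : 0 ≤ x) {k : ℕ} (hk : k ≠ 0) (he : e = (k : ℝ)⁻¹)
    (h : x ^ e ≤ y) : x ≤ y ^ k := by
  rw [← Real.rpow_inv_natCast_pow hx hk, ← he]
  exact pow_le_pow_left₀ (Real.rpow_nonneg hx _) h k

lemma lamBar_two_le_lamMax (Θ₀ : Params L n) : lamBar Θ₀ 2 ≤ lamMax Θ₀ := by
  unfold lamMax
  split_ifs
  · exact le_max_of_le_right (le_max_right _ _)
  · exact le_max_right _ _

lemma lamBar_one_le_lamMax (Θ₀ : Params L n) : lamBar Θ₀ 1 ≤ lamMax Θ₀ := by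
  unfold lamMax
  split_ifs
  · exact le_max_of_le_right (le_max_left _ _)
  · exact le_max_left _ _

lemma div_le_lamMax (hlam : ∀ l ∈ Finset.Icc 3 L, 0 < lamLow Θ₀ l) {l : ℕ}
    (hl : l ∈ Finset.Icc 3 L) :
    2 * lamBar Θ₀ 1 * lamBar Θ₀ 2 / (lamLow Θ₀ l * lamBar Θ₀ l) ≤ lamMax Θ₀ := by
  have hL := Finset.mem_Icc.1 hl
  have h1 := lamBar_pos hlam (show 1 ≤ L by omega)
  have h2 := lamBar_pos hlam (show 2 ≤ L by omega)
  rw [lamMax, dif_pos ⟨l, hl⟩]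
  refine le_max_of_le_left ?_
  have hinf : 0 < (Finset.Icc 3 L).inf' ⟨l, hl⟩ fun l => lamLow Θ₀ l * lamBar Θ₀ l :=
    (Finset.lt_inf'_iff _).2 fun j hj =>
      mul_pos (hlam j hj) (lamBar_pos hlam (Finset.mem_Icc.1 hj).2)
  exact div_le_div_of_nonneg_left (by positivity) hinf
    (Finset.inf'_le (fun l => lamLow Θ₀ l * lamBar Θ₀ l) hl)

/-- The condition on `Lambda1`, cleared of roots and denominators. -/
lemma mul_lamMax_le (hL : 2 ≤ L) (hγ : 0 < γ) (hlam : ∀ l ∈ Finset.Icc 3 L, 0 < lamLow Θ₀ l)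
    (h : Lambda1 γ α f₀ H Θ₀ ≤ lamH a H Θ₀) :
    2 * (3 / 2) ^ (L - 1) * (‖H‖ * √(2 * f₀) * lamBarProd Θ₀) * lamMax Θ₀ ≤
      backpropRate γ α H Θ₀ * lamH a H Θ₀ ^ 2 := by
  have hm := lamLowProd_pos hlam
  have hB := lamBarProd_pos hlam
  have hM : 0 < lamMax Θ₀ :=
    (lamBar_pos hlam (show 1 ≤ L by omega)).trans_le (lamBar_one_le_lamMax Θ₀)
  unfold Lambda1 at h
  rw [frobNorm_eq_norm] at h
  have h1 := le_pow_of_rpow_le (k := 2) (by positivity) two_ne_zero (by norm_num) h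
  have h2 := mul_le_mul_of_nonneg_left h1 (backpropRate_pos (α := α) (H := H) hγ hlam).le
  refine le_trans (le_of_eq ?_) h2
  have hexp : Real.exp (-(2 * alphaH H Θ₀ / α)) * Real.exp (2 * alphaH H Θ₀ / α) = 1 := by
    rw [← Real.exp_add]; simp
  have hdiv : lamLowProd Θ₀ ^ 2 * (lamBarProd Θ₀ / lamLowProd Θ₀ ^ 2) = lamBarProd Θ₀ := by
    field_simp
  rw [← depth_factor_eq hL hγ, backpropRate]
  calc _ = γ ^ 4 / 3 * (6 / γ ^ 2) ^ L * (γ ^ (2 * (L - 2)) * (1 / 2) ^ (2 * (L - 1))) *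
        (‖H‖ * √(2 * f₀) * (lamLowProd Θ₀ ^ 2 * (lamBarProd Θ₀ / lamLowProd Θ₀ ^ 2))) *
        lamMax Θ₀ * (Real.exp (-(2 * alphaH H Θ₀ / α)) * Real.exp (2 * alphaH H Θ₀ / α)) := by
        rw [hexp, hdiv]; ring
    _ = _ := by ring

/-- The condition on `Lambda2`, cleared of roots and denominators. -/
lemma mul_sigmaMax_le (hL : 2 ≤ L) (hγ : 0 < γ) (hlam : ∀ l ∈ Finset.Icc 3 L, 0 < lamLow Θ₀ l)
    (h : Lambda2 γ α f₀ H Θ₀ ≤ lamH a H Θ₀) :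
    2 * (3 / 2) ^ (L - 1) * (‖H‖ * √(2 * f₀) * lamBarProd Θ₀) * (2 * sigmaMax H * lamBar Θ₀ 2) ≤
      backpropRate γ α H Θ₀ * lamH a H Θ₀ ^ 3 := by
  have hm := lamLowProd_pos hlam
  have hB := lamBarProd_pos hlam
  have h2 := lamBar_pos hlam hL
  have hσ := sigmaMax_nonneg H
  unfold Lambda2 at h
  rw [frobNorm_eq_norm] at h
  have h1 := le_pow_of_rpow_le (k := 3) (by positivity) three_ne_zero (by norm_num) h
  have h2 := mul_le_mul_of_nonneg_left h1 (backpropRate_pos (α := α) (H := H) hγ hlam).le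
  refine le_trans (le_of_eq ?_) h2
  have hexp : Real.exp (-(2 * alphaH H Θ₀ / α)) * Real.exp (2 * alphaH H Θ₀ / α) = 1 := by
    rw [← Real.exp_add]; simp
  have hdiv : lamLowProd Θ₀ ^ 2 * (lamBarProd Θ₀ / lamLowProd Θ₀ ^ 2) = lamBarProd Θ₀ := by
    field_simp
  rw [← depth_factor_eq hL hγ, backpropRate]
  calc _ = γ ^ 4 / 3 * (6 / γ ^ 2) ^ L * (γ ^ (2 * (L - 2)) * (1 / 2) ^ (2 * (L - 1))) *
        (‖H‖ * √(2 * f₀) * (lamLowProd Θ₀ ^ 2 * (lamBarProd Θ₀ / lamLowProd Θ₀ ^ 2))) *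
        (2 * sigmaMax H * lamBar Θ₀ 2) *
        (Real.exp (-(2 * alphaH H Θ₀ / α)) * Real.exp (2 * alphaH H Θ₀ / α)) := by
        rw [hexp, hdiv]; ring
    _ = _ := by ring

end Constants

end WSR

namespace WSR

open Filter Topology
open scoped Matrix Matrix.Norms.Frobenius

/-! ### Supervised training -/

section Supervised

variable {L N : ℕ} {n : ℕ → ℕ} {γ β α P f₀ : ℝ} {a : ℝ → ℝ}
  {H : Matrix (Fin N) (Fin (n 0)) ℝ} {Θ₀ : Params L n}

/-- The distance the weight with index `l` is allowed to travel during training: half the smallest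
singular value from the third weight matrix on, `1` for the second, and for the first one exactly the
distance guaranteed by the decay of the gradients. -/
noncomputable def travelRadius (γ α f₀ : ℝ) (a : ℝ → ℝ) (H : Matrix (Fin N) (Fin (n 0)) ℝ)
    (Θ₀ : Params L n) (l : ℕ) : ℝ :=
  if l = 0 then 2 * (alphaH H Θ₀ / (3 / 2 * lamBar Θ₀ 1) * √(2 * f₀)) /
    (backpropRate γ α H Θ₀ * lamH a H Θ₀ ^ 2)
  else if l = 1 then 1 else lamLow Θ₀ (l + 1) / 2

lemma alphaH_div (hL : 2 ≤ L) (hlam : ∀ l ∈ Finset.Icc 3 L, 0 < lamLow Θ₀ l) {l : ℕ} (hl : l ≤ L) :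
    alphaH H Θ₀ / (3 / 2 * lamBar Θ₀ l) =
      (3 / 2) ^ (L - 1) * (‖H‖ * lamBarProd Θ₀) * (lamBar Θ₀ 1 * lamBar Θ₀ 2 / lamBar Θ₀ l) := by
  obtain ⟨k, rfl⟩ := Nat.exists_eq_add_of_le' hL
  have h := lamBar_pos hlam hl
  rw [alphaH_eq hL, show k + 2 - 1 = k + 1 by omega, pow_succ _ (k + 1)]
  field_simp

/-- The geometric decay of the loss keeps every weight matrix within its radius; this is where the
condition on `Lambda1` is used. -/
lemma two_mul_alphaH_div_le (hL : 2 ≤ L) (hγ : 0 < γ)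
    (hlam : ∀ l ∈ Finset.Icc 3 L, 0 < lamLow Θ₀ l) (hlamH : 0 < lamH a H Θ₀)
    (h : Lambda1 γ α f₀ H Θ₀ ≤ lamH a H Θ₀) {l : ℕ} (hl : l < L) :
    2 * (alphaH H Θ₀ / (3 / 2 * lamBar Θ₀ (l + 1)) * √(2 * f₀)) ≤
      backpropRate γ α H Θ₀ * lamH a H Θ₀ ^ 2 * travelRadius γ α f₀ a H Θ₀ l := by
  have hρ := backpropRate_pos (α := α) (H := H) hγ hlam
  have hmain := mul_lamMax_le hL hγ hlam h
  have hB := lamBarProd_pos hlam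
  unfold travelRadius
  split_ifs with h0 h1
  · subst h0
    rw [mul_div_cancel₀ _ (by positivity)]
  · subst h1
    have h1 := lamBar_pos hlam (show 1 ≤ L by omega)
    have h2 := lamBar_pos hlam hL
    rw [alphaH_div hL hlam hL, mul_one]
    refine le_trans ?_ hmain
    calc _ = 2 * (3 / 2) ^ (L - 1) * (‖H‖ * √(2 * f₀) * lamBarProd Θ₀) * lamBar Θ₀ 1 := by
          field_simp
      _ ≤ _ := by gcongr; exact lamBar_one_le_lamMax Θ₀
  · have hmem : l + 1 ∈ Finset.Icc 3 L := Finset.mem_Icc.2 (by omega)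
    have h1 := lamBar_pos hlam (show l + 1 ≤ L by omega)
    have h2 := hlam _ hmem
    rw [alphaH_div hL hlam (show l + 1 ≤ L by omega)]
    calc _ = 2 * (3 / 2) ^ (L - 1) * (‖H‖ * √(2 * f₀) * lamBarProd Θ₀) *
          (2 * lamBar Θ₀ 1 * lamBar Θ₀ 2 / (lamLow Θ₀ (l + 1) * lamBar Θ₀ (l + 1))) *
          (lamLow Θ₀ (l + 1) / 2) := by field_simp
      _ ≤ 2 * (3 / 2) ^ (L - 1) * (‖H‖ * √(2 * f₀) * lamBarProd Θ₀) * lamMax Θ₀ *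
          (lamLow Θ₀ (l + 1) / 2) := by gcongr; exact div_le_lamMax hlam hmem
      _ ≤ _ := by gcongr

lemma travelRadius_zero_le_one (hL : 2 ≤ L) (hγ : 0 < γ)
    (hlam : ∀ l ∈ Finset.Icc 3 L, 0 < lamLow Θ₀ l) (hlamH : 0 < lamH a H Θ₀)
    (h : Lambda1 γ α f₀ H Θ₀ ≤ lamH a H Θ₀) : travelRadius γ α f₀ a H Θ₀ 0 ≤ 1 := by
  have hρ := backpropRate_pos (α := α) (H := H) hγ hlam
  have hB := lamBarProd_pos hlam
  have h1 := lamBar_pos hlam (show 1 ≤ L by omega)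
  rw [travelRadius, if_pos rfl, div_le_one (by positivity), alphaH_div hL hlam (by omega)]
  refine le_trans ?_ (mul_lamMax_le hL hγ hlam h)
  calc _ = 2 * (3 / 2) ^ (L - 1) * (‖H‖ * √(2 * f₀) * lamBarProd Θ₀) * lamBar Θ₀ 2 := by
        field_simp
    _ ≤ _ := by gcongr; exact lamBar_two_le_lamMax Θ₀

/-- The travel of the first weight matrix moves the first hidden layer by at most half its smallest
singular value; this is where the condition on `Lambda2` is used. -/
lemma sigmaMax_mul_travelRadius_zero_le (hL : 2 ≤ L) (hγ : 0 < γ)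
    (hlam : ∀ l ∈ Finset.Icc 3 L, 0 < lamLow Θ₀ l) (hlamH : 0 < lamH a H Θ₀)
    (h : Lambda2 γ α f₀ H Θ₀ ≤ lamH a H Θ₀) :
    sigmaMax H * travelRadius γ α f₀ a H Θ₀ 0 ≤ lamH a H Θ₀ / 2 := by
  have hρ := backpropRate_pos (α := α) (H := H) hγ hlam
  have h1 := lamBar_pos hlam (show 1 ≤ L by omega)
  rw [travelRadius, if_pos rfl, alphaH_div hL hlam (by omega), mul_div_assoc',
    div_le_iff₀ (by positivity)]
  have h2 := mul_sigmaMax_le hL hγ hlam h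
  have h3 : sigmaMax H * (2 * ((3 / 2) ^ (L - 1) * (‖H‖ * lamBarProd Θ₀) *
      (lamBar Θ₀ 1 * lamBar Θ₀ 2 / lamBar Θ₀ 1) * √(2 * f₀))) =
      2 * (3 / 2) ^ (L - 1) * (‖H‖ * √(2 * f₀) * lamBarProd Θ₀) *
        (2 * sigmaMax H * lamBar Θ₀ 2) / 2 := by field_simp
  rw [h3]
  linarith

lemma travelRadius_nonneg (hγ : 0 < γ) (hL : 2 ≤ L)
    (hlam : ∀ l ∈ Finset.Icc 3 L, 0 < lamLow Θ₀ l) {l : ℕ} (hl : l < L) :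
    0 ≤ travelRadius γ α f₀ a H Θ₀ l := by
  have hρ := backpropRate_pos (α := α) (H := H) hγ hlam
  have hB := lamBarProd_pos hlam
  have h1 := lamBar_pos hlam (show 1 ≤ L by omega)
  have h2 := lamBar_pos hlam hL
  unfold travelRadius
  split_ifs
  · rw [alphaH_eq hL]
    positivity
  · exact zero_le_one
  · have := hlam (l + 1) (Finset.mem_Icc.2 (by omega))
    positivity

lemma sigmaMax_add_travelRadius_le (hL : 2 ≤ L) (hγ : 0 < γ)
    (hlam : ∀ l ∈ Finset.Icc 3 L, 0 < lamLow Θ₀ l) (hlamH : 0 < lamH a H Θ₀)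
    (h : Lambda1 γ α f₀ H Θ₀ ≤ lamH a H Θ₀) (l : ℕ) :
    sigmaMax (weight Θ₀ l) + travelRadius γ α f₀ a H Θ₀ l ≤ 3 / 2 * lamBar Θ₀ (l + 1) := by
  have hzero := travelRadius_zero_le_one hL hγ hlam hlamH h
  rcases Nat.lt_or_ge l 2 with hl | hl
  · have hr : travelRadius γ α f₀ a H Θ₀ l ≤ 1 := by
      interval_cases l
      · exact hzero
      · simp [travelRadius]
    rw [lamBar, if_pos (by omega), Nat.add_sub_cancel]
    linarith
  · rw [lamBar, if_neg (by omega), travelRadius, if_neg (by omega), if_neg (by omega),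
      Nat.add_sub_cancel]
    have : lamLow Θ₀ (l + 1) ≤ sigmaMax (weight Θ₀ l) := sigmaMin_le_sigmaMax _
    linarith

/-- The Polyak–Łojasiewicz inequality, from the gradient with respect to the second weight matrix
alone. -/
lemma polyak_lojasiewicz_lossSL (hL : 2 ≤ L) (hN : 0 < N) (hwidth_one : N ≤ n 1)
    (hwidth : ∀ l, 1 ≤ l → l < L → n (l + 1) ≤ n l) (ha : IsActivation γ β a) (hα : 0 < α)
    (hP : 0 < P) (hlam : ∀ l ∈ Finset.Icc 3 L, 0 < lamLow Θ₀ l) (hlamH : 0 < lamH a H Θ₀)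
    (h1 : Lambda1 γ α f₀ H Θ₀ ≤ lamH a H Θ₀) (h2 : Lambda2 γ α f₀ H Θ₀ ≤ lamH a H Θ₀)
    (pbar : Fin N → Fin (n L) → ℝ) {Θ : Params L n}
    (hΘ : ∀ l : Fin L, ‖weight (Θ - Θ₀) l‖ ≤ travelRadius γ α f₀ a H Θ₀ l) :
    2 * (backpropRate γ α H Θ₀ * lamH a H Θ₀ ^ 2) * lossSL a α P H pbar Θ ≤
      ‖gradient (lossSL a α P H pbar) Θ‖ ^ 2 := by
  have hγ := ha.gamma_mem.1
  have hnear : ∀ l < L, ‖weight Θ l - weight Θ₀ l‖ ≤ travelRadius γ α f₀ a H Θ₀ l :=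
    fun l hl => by rw [← weight_sub]; exact hΘ ⟨l, hl⟩
  have hs0 : ∀ l < L, 0 ≤ 3 / 2 * lamBar Θ₀ (l + 1) := fun l hl => by
    have := lamBar_pos hlam (show l + 1 ≤ L from hl)
    positivity
  have hs : ∀ l < L, ∀ X : Matrix (Fin N) (Fin (n l)) ℝ,
      ‖X * weight Θ l‖ ≤ 3 / 2 * lamBar Θ₀ (l + 1) * ‖X‖ := fun l hl X =>
    (norm_mul_le_of_near (hnear l hl) X).trans
      (by gcongr; exact sigmaMax_add_travelRadius_le hL hγ hlam hlamH h1 l)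
  have ht0 : ∀ l, 2 ≤ l → l < L → 0 ≤ lamLow Θ₀ (l + 1) / 2 := fun l hl hlL => by
    have := hlam (l + 1) (Finset.mem_Icc.2 (by omega))
    positivity
  have ht : ∀ l, 2 ≤ l → l < L → ∀ X : Matrix (Fin N) (Fin (n (l + 1))) ℝ,
      lamLow Θ₀ (l + 1) / 2 * ‖X‖ ≤ ‖X * (weight Θ l)ᵀ‖ := fun l hl hlL X => by
    have h3 := le_norm_mul_transpose_of_near (hwidth l (by omega) hlL) (hnear l hlL) X
    rw [travelRadius, if_neg (by omega), if_neg (by omega)] at h3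
    have h4 : sigmaMin (weight Θ₀ l) = lamLow Θ₀ (l + 1) := rfl
    rw [h4] at h3
    linarith
  set E := residual a (screlu α P) H pbar Θ
  have hδ := le_norm_delta (Θ := Θ) (H := H) (P := P) (α := α) ha (Real.exp_nonneg _)
    (fun l hl i j => exp_le_slope_last ha hα hP hs0 hs hl i j) ht ht0 E (L - 2) 1 le_rfl
    (by omega) (by omega)
  rw [← alphaH_eq_prod, prod_Ico_lamLow] at hδ
  have hF1 : ‖layer a (screlu α P) H Θ 1 - (H * weight Θ₀ 0).map a‖ ≤ lamH a H Θ₀ / 2 :=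
    (norm_layer_one_sub_le ha _ hL Θ Θ₀).trans
      ((mul_le_mul_of_nonneg_left (hΘ ⟨0, by omega⟩) (sigmaMax_nonneg H)).trans
        (sigmaMax_mul_travelRadius_zero_le hL hγ hlam hlamH h2))
  have hgrad : lamH a H Θ₀ / 2 * ‖delta a (screlu α P) H Θ E (show 1 < L by omega)‖ ≤
      ‖gradient (lossSL a α P H pbar) Θ‖ := by
    refine le_trans ?_ (norm_weight_le _ ⟨1, by omega⟩)
    rw [weight_gradient_lossSL ha.c11At hα hP H pbar Θ (by omega : 1 < L)]
    refine le_trans ?_ (le_norm_transpose_mul_of_near hN hwidth_one hF1 _)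
    have : sigmaMin ((H * weight Θ₀ 0).map a) = lamH a H Θ₀ := rfl
    rw [this]
    exact le_of_eq (by ring)
  have hlow := lamLowProd_pos hlam
  have hfinal := (mul_le_mul_of_nonneg_left hδ (by positivity : 0 ≤ lamH a H Θ₀ / 2)).trans hgrad
  have hsq := pow_le_pow_left₀ (by positivity) hfinal 2
  refine le_trans (le_of_eq ?_) hsq
  have hE : lossSL a α P H pbar Θ = ‖E‖ ^ 2 / 2 := by
    have := lossSL_nonneg (a := a) (α := α) (P := P) H pbar Θ
    rw [norm_residual, Real.sq_sqrt (by positivity)]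
    ring
  have hexp : Real.exp (-alphaH H Θ₀ / α) ^ 2 = Real.exp (-(2 * alphaH H Θ₀ / α)) := by
    rw [← Real.exp_nat_mul]
    congr 1
    push_cast
    ring
  obtain ⟨k, rfl⟩ := Nat.exists_eq_add_of_le' hL
  rw [backpropRate, ← hexp, hE,
    show k + 2 - 2 = k by omega, show k + 2 - 1 = k + 1 by omega]
  ring

/-- The gradient with respect to one weight matrix is at most a constant times the size of the
residual. -/
lemma norm_weight_gradient_lossSL_le (hL : 2 ≤ L) (ha : IsActivation γ β a) (hα : 0 < α)
    (hP : 0 < P) (hlam : ∀ l ∈ Finset.Icc 3 L, 0 < lamLow Θ₀ l) (hlamH : 0 < lamH a H Θ₀)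
    (h1 : Lambda1 γ α f₀ H Θ₀ ≤ lamH a H Θ₀) (pbar : Fin N → Fin (n L) → ℝ) {Θ : Params L n}
    (hΘ : ∀ l : Fin L, ‖weight (Θ - Θ₀) l‖ ≤ travelRadius γ α f₀ a H Θ₀ l) {l : ℕ} (hl : l < L) :
    ‖weight (gradient (lossSL a α P H pbar) Θ) l‖ ≤
      alphaH H Θ₀ / (3 / 2 * lamBar Θ₀ (l + 1)) * √(2 * lossSL a α P H pbar Θ) := by
  have hγ := ha.gamma_mem.1
  have hnear : ∀ l < L, ‖weight Θ l - weight Θ₀ l‖ ≤ travelRadius γ α f₀ a H Θ₀ l :=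
    fun l hl => by rw [← weight_sub]; exact hΘ ⟨l, hl⟩
  rw [alphaH_eq_prod]
  refine norm_weight_gradient_le (s := fun l => 3 / 2 * lamBar Θ₀ (l + 1)) ha hα hP
    (fun l hl => ?_) (fun l hl X => ?_) (fun l hl X => ?_) pbar hl
  · have := lamBar_pos hlam (show l + 1 ≤ L from hl)
    positivity
  · exact (norm_mul_le_of_near (hnear l hl) X).trans
      (by gcongr; exact sigmaMax_add_travelRadius_le hL hγ hlam hlamH h1 l)
  · exact (norm_mul_transpose_le_of_near (hnear l hl) X).trans
      (by gcongr; exact sigmaMax_add_travelRadius_le hL hγ hlam hlamH h1 l)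

theorem supervised_training (hL : 2 ≤ L) (hN : 0 < N) (hwidth_one : N ≤ n 1)
    (hwidth : ∀ l, 1 ≤ l → l < L → n (l + 1) ≤ n l) (ha : IsActivation γ β a) (hα : 0 < α)
    (hP : 0 < P) (pbar : Fin N → Fin (n L) → ℝ)
    (hlam : ∀ l ∈ Finset.Icc 3 L, 0 < lamLow Θ₀ l) (hlamH : 0 < lamH a H Θ₀)
    (h1 : Lambda1 γ α (lossSL a α P H pbar Θ₀) H Θ₀ ≤ lamH a H Θ₀)
    (h2 : Lambda2 γ α (lossSL a α P H pbar Θ₀) H Θ₀ ≤ lamH a H Θ₀) :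
    ∃ ηbar : ℝ, 0 < ηbar ∧ ∀ η : ℝ, 0 < η → η < ηbar →
      η * (backpropRate γ α H Θ₀ * lamH a H Θ₀ ^ 2) < 1 ∧
      (∃ Θstar : Params L n,
        Tendsto (gd (lossSL a α P H pbar) η Θ₀) atTop (𝓝 Θstar) ∧
        lossSL a α P H pbar Θstar = 0) ∧
      ∀ m : ℕ, lossSL a α P H pbar (gd (lossSL a α P H pbar) η Θ₀ m) ≤
        (1 - η * (backpropRate γ α H Θ₀ * lamH a H Θ₀ ^ 2)) ^ m * lossSL a α P H pbar Θ₀ := by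
  have hγ := ha.gamma_mem.1
  set f₀ := lossSL a α P H pbar Θ₀ with hf₀
  have hαH : 0 ≤ alphaH H Θ₀ := by
    have := lamBarProd_pos hlam
    have := lamBar_pos hlam (show 1 ≤ L by omega)
    have := lamBar_pos hlam hL
    rw [alphaH_eq hL]
    positivity
  obtain ⟨ηbar, hηbar, h⟩ := exists_gradient_descent_linear_convergence
    (ι := Fin L) (f := lossSL a α P H pbar) (x₀ := Θ₀)
    (fun l => (normSeminorm ℝ (Matrix (Fin (n l)) (Fin (n (l + 1))) ℝ)).comp (weightLin L n l))
    (fun l => alphaH H Θ₀ / (3 / 2 * lamBar Θ₀ (l + 1)))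
    (fun l => travelRadius γ α f₀ a H Θ₀ l)
    (mul_pos (backpropRate_pos (α := α) (H := H) hγ hlam) (pow_pos hlamH 2)) rfl
    (isCompact_weight_near Θ₀ _) (c11At_lossSL ha.c11At hα hP H pbar) (lossSL_nonneg H pbar)
    (fun Θ hΘ => polyak_lojasiewicz_lossSL hL hN hwidth_one hwidth ha hα hP hlam hlamH h1 h2 pbar hΘ)
    (fun l => by
      have := lamBar_pos hlam (show (l : ℕ) + 1 ≤ L from l.2)
      positivity)
    (fun l => travelRadius_nonneg hγ hL hlam l.2)
    (fun Θ hΘ l => norm_weight_gradient_lossSL_le hL ha hα hP hlam hlamH h1 pbar hΘ l.2)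
    (fun l => two_mul_alphaH_div_le hL hγ hlam hlamH h1 l.2)
  refine ⟨ηbar, hηbar, fun η hη hlt => ?_⟩
  obtain ⟨h3, h4⟩ := h η hη hlt
  exact ⟨h3, h4 (gd (lossSL a α P H pbar) η Θ₀) rfl fun _ => rfl⟩

lemma alpha0_pos (hγ : 0 < γ) (hlam : ∀ l ∈ Finset.Icc 3 L, 0 < lamLow Θ₀ l)
    (hlamH : 0 < lamH a H Θ₀) : 0 < alpha0 γ a H Θ₀ := by
  have := lamLowProd_pos hlam
  unfold alpha0
  positivity

lemma alpha0_le (hγ : 0 < γ) (hα : 0 < α) (h : alphaH H Θ₀ ≤ α) :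
    alpha0 γ a H Θ₀ ≤ backpropRate γ α H Θ₀ * lamH a H Θ₀ ^ 2 := by
  have h1 : Real.exp (-2) ≤ Real.exp (-(2 * alphaH H Θ₀ / α)) := by
    rw [Real.exp_le_exp, neg_le_neg_iff, div_le_iff₀ hα]
    linarith
  unfold alpha0 backpropRate
  gcongr

end Supervised

/-! ### Unsupervised training -/

section Unsupervised

variable {L N : ℕ} {n : ℕ → ℕ} {α P : ℝ} {a : ℝ → ℝ} {H : Matrix (Fin N) (Fin (n 0)) ℝ}

lemma c11At_interference (ha : ∀ x, C11At a x) (hα : 0 < α) (hP : 0 < P)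
    (σ : Fin (n L) → ℝ) (g : Fin (n L) → Fin (n L) → ℝ) (r : Fin N) (k : Fin (n L))
    (Θ : Params L n) : C11At (fun Θ => interference σ g (output a α P H Θ r) k) Θ :=
  (C11At.sum _ fun j _ => (c11At_const _ _).mul (c11At_output ha hα hP H Θ r j)).add
    (c11At_const _ _)

lemma c11At_signal (ha : ∀ x, C11At a x) (hα : 0 < α) (hP : 0 < P)
    (g : Fin (n L) → Fin (n L) → ℝ) (r : Fin N) (k : Fin (n L)) (Θ : Params L n) :
    C11At (fun Θ => g k k ^ 2 * output a α P H Θ r k) Θ :=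
  (c11At_const _ _).mul (c11At_output ha hα hP H Θ r k)

/-- The unsupervised loss is regular where interference and total received power are positive. -/
lemma c11At_lossUL (ha : ∀ x, C11At a x) (hα : 0 < α) (hP : 0 < P) (w σ : Fin (n L) → ℝ)
    (g : Fin N → Fin (n L) → Fin (n L) → ℝ) {Θ : Params L n}
    (hI : ∀ r k, 0 < interference σ (g r) (output a α P H Θ r) k)
    (hS : ∀ r k, 0 < interference σ (g r) (output a α P H Θ r) k +
      g r k k ^ 2 * output a α P H Θ r k) :
    C11At (lossUL a α P H w σ g) Θ := by
  refine C11At.sum _ fun r _ => (C11At.sum _ fun k _ => (c11At_const _ _).mul ?_).neg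
  refine C11At.comp (g := fun q : ℝ × ℝ => Real.log (1 + q.1 / q.2)) ?_
    ((c11At_signal ha hα hP (g r) r k Θ).prodMk (c11At_interference ha hα hP σ (g r) r k Θ))
  refine c11At_of_contDiffAt (ContDiffAt.log (contDiffAt_const.add
    (contDiffAt_fst.div contDiffAt_snd (hI r k).ne')) ?_)
  have h1 := hI r k
  have h2 := hS r k
  have h3 : 1 + g r k k ^ 2 * output a α P H Θ r k /
      interference σ (g r) (output a α P H Θ r) k =
      (interference σ (g r) (output a α P H Θ r) k + g r k k ^ 2 * output a α P H Θ r k) /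
        interference σ (g r) (output a α P H Θ r) k := by
    field_simp
  exact (h3 ▸ div_pos h2 h1).ne'

theorem unsupervised_training (ha : ∀ x, C11At a x) (hα : 0 < α) (hP : 0 < P)
    (w σ : Fin (n L) → ℝ) (g : Fin N → Fin (n L) → Fin (n L) → ℝ) (Θ₀ : Params L n)
    (B : ℝ) {δ : ℝ} (hδ : 0 < δ) :
    ∃ ηbar : ℝ, 0 < ηbar ∧ ∀ η : ℝ, 0 < η → η < ηbar →
      ∀ Θ : ℕ → Params L n, Θ = gd (lossUL a α P H w σ g) η Θ₀ → (∀ m, ‖Θ m‖ ≤ B) →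
        (∀ m r k, δ ≤ interference σ (g r) (output a α P H (Θ m) r) k ∧
          δ ≤ interference σ (g r) (output a α P H (Θ m) r) k +
            g r k k ^ 2 * output a α P H (Θ m) r k) →
        Tendsto (fun m => gradient (lossUL a α P H w σ g) (Θ m)) atTop (𝓝 0) := by
  have hcI : ∀ r k, Continuous fun Θ : Params L n =>
      interference σ (g r) (output a α P H Θ r) k := fun r k =>
    continuous_iff_continuousAt.2 fun Θ =>
      (c11At_interference ha hα hP σ (g r) r k Θ).contDiffAt.continuousAt
  have hcS : ∀ r k, Continuous fun Θ : Params L n => g r k k ^ 2 * output a α P H Θ r k :=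
    fun r k => continuous_iff_continuousAt.2 fun Θ =>
      (c11At_signal ha hα hP (g r) r k Θ).contDiffAt.continuousAt
  have hclosed : IsClosed {Θ : Params L n | ∀ r k,
      δ ≤ interference σ (g r) (output a α P H Θ r) k ∧
        δ ≤ interference σ (g r) (output a α P H Θ r) k + g r k k ^ 2 * output a α P H Θ r k} := by
    simp only [Set.ofPred_forall, Set.ofPred_and]
    exact isClosed_iInter fun r => isClosed_iInter fun k =>
      (isClosed_le continuous_const (hcI r k)).inter
        (isClosed_le continuous_const ((hcI r k).add (hcS r k)))
  have hC := (isCompact_closedBall (0 : Params L n) B).inter_right hclosed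
  obtain ⟨ηbar, hηbar, h⟩ := exists_tendsto_gradient_zero hC (f := lossUL a α P H w σ g)
    fun Θ hΘ => c11At_lossUL ha hα hP w σ g (fun r k => hδ.trans_le (hΘ.2 r k).1)
      fun r k => hδ.trans_le (hΘ.2 r k).2
  refine ⟨ηbar, hηbar, fun η hη hlt Θ hΘ hB hreg => h η hη hlt Θ (fun m => ⟨?_, hreg m⟩) ?_⟩
  · simpa using hB m
  · subst hΘ
    exact fun m => rfl

end Unsupervised

end WSR

theorem claim3
    -- depth, sample size and widths; the number of users is `K = n L`, and `n 0 = K²` by `e`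
    (L N : ℕ) (n : ℕ → ℕ) (hL : 2 ≤ L) (hN : 2 ≤ N) (hK : 2 ≤ n L)
    (e : Fin (n 0) ≃ Fin (n L) × Fin (n L))
    (hwidth_one : N ≤ n 1) (hwidth : ∀ l, 1 ≤ l → l < L → n (l + 1) ≤ n l)
    -- channels, weights, noise levels, power budget, stationary labels
    (h : Fin N → Fin (n L) → Fin (n L) → ℂ)
    (w σ : Fin (n L) → ℝ) (hw : ∀ k, 0 ≤ w k) (hσ : ∀ k, 0 < σ k)
    (Pmax : ℝ) (hP : 0 < Pmax)
    (pbar : Fin N → Fin (n L) → ℝ)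
    (hlabel : ∀ r, WSR.IsKKT w σ Pmax (WSR.absChannel h r) (pbar r))
    -- hidden activation and SCReLU parameter
    (γ β : ℝ) (a : ℝ → ℝ) (ha : WSR.IsActivation γ β a) (α : ℝ) (hα : 0 < α)
    (H : Matrix (Fin N) (Fin (n 0)) ℝ) (hH : H = WSR.inputMatrix e h)
    -- initialization
    (Θ₀ : WSR.Params L n)
    (hlam : ∀ l ∈ Finset.Icc 3 L, 0 < WSR.lamLow Θ₀ l) (hlamH : 0 < WSR.lamH a H Θ₀)
    (hinit : max (WSR.Lambda1 γ α (WSR.lossSL a α Pmax H pbar Θ₀) H Θ₀)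
        (WSR.Lambda2 γ α (WSR.lossSL a α Pmax H pbar Θ₀) H Θ₀) ≤ WSR.lamH a H Θ₀) :
    -- supervised training
    (WSR.alphaH H Θ₀ ≤ α →
      0 < WSR.alpha0 γ a H Θ₀ ∧
      ∃ ηbar : ℝ, 0 < ηbar ∧ ∀ η : ℝ, 0 < η → η < ηbar →
        η * WSR.alpha0 γ a H Θ₀ < 1 ∧
        (∃ Θstar : WSR.Params L n,
          Filter.Tendsto (WSR.gd (WSR.lossSL a α Pmax H pbar) η Θ₀) Filter.atTop (nhds Θstar) ∧
          WSR.lossSL a α Pmax H pbar Θstar = 0) ∧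
        ∀ m : ℕ, WSR.lossSL a α Pmax H pbar (WSR.gd (WSR.lossSL a α Pmax H pbar) η Θ₀ m) ≤
          (1 - η * WSR.alpha0 γ a H Θ₀) ^ m * WSR.lossSL a α Pmax H pbar Θ₀) ∧
    -- unsupervised training: iterates bounded by `B`, and staying `δ`-inside the region where the
    -- rates are defined (`interference > 0` and `1 + SINR > 0`)
    (∀ B δ : ℝ, 0 < δ →
      ∃ ηbar : ℝ, 0 < ηbar ∧ ∀ η : ℝ, 0 < η → η < ηbar →
        ∀ Θ : ℕ → WSR.Params L n,
          Θ = WSR.gd (WSR.lossUL a α Pmax H w σ (WSR.absChannel h)) η Θ₀ →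
          (∀ m, ‖Θ m‖ ≤ B) →
          (∀ m r k,
            δ ≤ WSR.interference σ (WSR.absChannel h r) (WSR.output a α Pmax H (Θ m) r) k ∧
            δ ≤ WSR.interference σ (WSR.absChannel h r) (WSR.output a α Pmax H (Θ m) r) k +
              WSR.absChannel h r k k ^ 2 * WSR.output a α Pmax H (Θ m) r k) →
          Filter.Tendsto
            (fun m => gradient (WSR.lossUL a α Pmax H w σ (WSR.absChannel h)) (Θ m))
            Filter.atTop (nhds 0)) := by
  have hγ := ha.gamma_mem.1
  refine ⟨fun hαH => ⟨WSR.alpha0_pos hγ hlam hlamH, ?_⟩, fun B δ hδ =>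
    WSR.unsupervised_training ha.c11At hα hP w σ (WSR.absChannel h) Θ₀ B hδ⟩
  obtain ⟨ηbar, hηbar, hsup⟩ := WSR.supervised_training hL (by omega) hwidth_one hwidth ha hα hP pbar
    hlam hlamH ((le_max_left _ _).trans hinit) ((le_max_right _ _).trans hinit)
  refine ⟨ηbar, hηbar, fun η hη hlt => ?_⟩
  obtain ⟨h1, h2, h3⟩ := hsup η hη hlt
  -- the rate obtained above is at least `alpha0`, because `alphaH ≤ α`
  have hrate := mul_le_mul_of_nonneg_left (WSR.alpha0_le (a := a) hγ hα hαH) hη.le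
  refine ⟨hrate.trans_lt h1, h2, fun m => (h3 m).trans ?_⟩
  refine mul_le_mul_of_nonneg_right (pow_le_pow_left₀ (by linarith) (by linarith) m)
    (WSR.lossSL_nonneg H pbar Θ₀)
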